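/- Let $\mathcal K$ be an algebraically closed field, $V$ a nonzero finite-dimensional vector space over $\mathcal K$, and $q\in\mathcal K$ nonzero and not a root of unity. For a diagonalizable map $A$ on $V$ with distinct eigenvalues $\theta_0,\dots,\theta_d$, the primitive idempotent for $\theta_i$ is $E_i=\prod_{j\ne i}\frac{A-\theta_jI}{\theta_i-\theta_j}$. A *parallel system* on $V$ is a sequence $\Phi=(A;\{E_i\}_{i=0}^d;A^*;\{E^*_i\}_{i=0}^d)$ in which $A,A^*$ are diagonalizable linear maps on $V$ and $\{E_i\}$, $\{E^*_i\}$ are orderings of the primitive idempotents of $A$, $A^*$; let $\theta_i$, $\theta^*_i$ be the eigenvalues of $A$, $A^*$ corresponding to $E_i$, $E^*_i$. It is *sharp* if $\dim E^*_0V=1$. In that case $E^*_0(A-\theta_0I)\cdots(A-\theta_{i-1}I)$ acts on $E^*_0V$ as a scalar $\chi_i$; the *split sequence* of $\Phi$ is $\zeta_i=(\theta^*_0-\theta^*_1)\cdots(\theta^*_0-\theta^*_i)\chi_i$ $(0\le i\le d)$, and the *parameter array* of $\Phi$ is $(\{\theta_i\}_{i=0}^d,\{\theta^*_i\}_{i=0}^d,\{\zeta_i\}_{i=0}^d)$.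 A *tridiagonal system* is a parallel system such that $E_iA^*E_j=0=E^*_iAE^*_j$ whenever $|i-j|>1$, and such that the only subspaces of $V$ invariant under both $A$ and $A^*$ are $0$ and $V$. Let $\Phi=(A;\{E_i\}_{i=0}^d;A^*;\{E^*_i\}_{i=0}^d)$ be a tridiagonal system on $V$ with $\theta_i=q^{2i-d}$ and $\theta^*_i=q^{d-2i}$ for $0\le i\le d$. Then $\Phi$ is a sharp parallel system, and there is a unique direct sum decomposition $V=U_0\oplus\cdots\oplus U_d$ into nonzero subspaces that is split with respect to $\Phi$, that is, $(A-\theta_iI)U_i\subseteq U_{i+1}$ and $(A^*-\theta^*_iI)U_i\subseteq U_{i-1}$ for $0\le i\le d$, where $U_{-1}=U_{d+1}=0$. Let $K$ be the unique linear map on $V$ such that $U_i$ is the eigenspace of $K$ for the eigenvalue $q^{d-2i}$, $0\le i\le d$. For any scalar $t\in\mathcal K$ put $B=A$ and $B^*=tA^*+(1-t)K$, let $E'_i=\prod_{j\ne i}\frac{B^*-\theta^*_jI}{\theta^*_i-\theta^*_j}$, and let $\Phi'=(B;\{E_i\}_{i=0}^d;B^*;\{E'_i\}_{i=0}^d)$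 be the $t$-linear perturbation of $\Phi$. Then $\Phi'$ is a sharp parallel system, and its parameter array is $(\{\theta_i\}_{i=0}^d,\{\theta^*_i\}_{i=0}^d,\{t^i\zeta_i\}_{i=0}^d)$, where $\{\zeta_i\}_{i=0}^d$ is the split sequence of $\Phi$. That is, the split sequence $\{\zeta'_i\}_{i=0}^d$ of $\Phi'$ is given by $\zeta'_i=t^i\zeta_i$ for $0\le i\le d$ (with $0^0=1$). -/

import Mathlib

open scoped Polynomial

noncomputable section

namespace TridiagonalPerturbation

variable {𝕜 V : Type*} [Field 𝕜] [AddCommGroup V] [Module 𝕜 V] {d : ℕ}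

/-- A linear map is diagonalizable whenever `V` is spanned by its eigenspaces. -/
def IsDiagonalizable (A : Module.End 𝕜 V) : Prop :=
  ⨆ μ : 𝕜, A.eigenspace μ = ⊤

/-- The primitive idempotent `∏_{j ≠ i} (A - θ_j I) / (θ_i - θ_j)` of `A`, for a list `θ` of the
eigenvalues of `A`; the Lagrange basis polynomial is `∏_{j ≠ i} (x - θ_j) / (θ_i - θ_j)`. -/
def primitiveIdempotent (A : Module.End 𝕜 V) (θ : Fin (d + 1) → 𝕜) (i : Fin (d + 1)) :
    Module.End 𝕜 V :=
  Polynomial.aeval A (Lagrange.basis Finset.univ θ i)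

/-- `θ` lists the eigenvalues of `A` without repetition and `E i` is the primitive idempotent of
`A` for the eigenvalue `θ i`. -/
structure IsIdempotentOrdering (A : Module.End 𝕜 V) (E : Fin (d + 1) → Module.End 𝕜 V)
    (θ : Fin (d + 1) → 𝕜) : Prop where
  injective : Function.Injective θ
  hasEigenvalue_iff : ∀ μ : 𝕜, A.HasEigenvalue μ ↔ ∃ i, θ i = μ
  eq_primitiveIdempotent : ∀ i, E i = primitiveIdempotent A θ i

variable (𝕜 V d) in
/-- A parallel system `(A; {E_i}; A*; {E*_i})` on `V`: the maps `A` and `A*` are diagonalizable,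
and `{E_i}`, `{E*_i}` are orderings of the primitive idempotents of `A`, `A*`. -/
structure ParallelSystem where
  A : Module.End 𝕜 V
  E : Fin (d + 1) → Module.End 𝕜 V
  Astar : Module.End 𝕜 V
  Estar : Fin (d + 1) → Module.End 𝕜 V
  diag : IsDiagonalizable A
  diag_star : IsDiagonalizable Astar
  ordering : ∃ θ : Fin (d + 1) → 𝕜, IsIdempotentOrdering A E θ
  ordering_star : ∃ θ : Fin (d + 1) → 𝕜, IsIdempotentOrdering Astar Estar θ

namespace ParallelSystem

/-- `θ_i`, the eigenvalue of `A` corresponding to `E_i`. -/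
def eigenvalue (Φ : ParallelSystem 𝕜 V d) : Fin (d + 1) → 𝕜 :=
  Φ.ordering.choose

/-- `θ*_i`, the eigenvalue of `A*` corresponding to `E*_i`. -/
def dualEigenvalue (Φ : ParallelSystem 𝕜 V d) : Fin (d + 1) → 𝕜 :=
  Φ.ordering_star.choose

/-- A parallel system is sharp whenever `dim (E*_0 V) = 1`. -/
def IsSharp (Φ : ParallelSystem 𝕜 V d) : Prop :=
  Module.finrank 𝕜 (LinearMap.range (Φ.Estar 0)) = 1

/-- The polynomial `τ_i = (x - θ_0) (x - θ_1) ⋯ (x - θ_{i-1})`. -/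
def tau (Φ : ParallelSystem 𝕜 V d) (i : Fin (d + 1)) : 𝕜[X] :=
  ∏ j ∈ Finset.Iio i, (Polynomial.X - Polynomial.C (Φ.eigenvalue j))

/-- On the one-dimensional space `E*_0 V` the map `E*_0 τ_i(A)` acts as a scalar. -/
theorem exists_chi (Φ : ParallelSystem 𝕜 V d) (h : Φ.IsSharp) (i : Fin (d + 1)) :
    ∃ c : 𝕜, ∀ v ∈ LinearMap.range (Φ.Estar 0),
      (Φ.Estar 0 * Polynomial.aeval Φ.A (Φ.tau i)) v = c • v := by
  obtain ⟨w, -, hw⟩ := finrank_eq_one_iff'.mp h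
  obtain ⟨c, hc⟩ := hw ⟨(Φ.Estar 0 * Polynomial.aeval Φ.A (Φ.tau i)) w, ⟨_, rfl⟩⟩
  refine ⟨c, fun v hv => ?_⟩
  obtain ⟨a, ha⟩ := hw ⟨v, hv⟩
  have ha' : a • (w : V) = v := congrArg Subtype.val ha
  have hc' : c • (w : V) = (Φ.Estar 0 * Polynomial.aeval Φ.A (Φ.tau i)) w :=
    congrArg Subtype.val hc
  rw [← ha', map_smul, ← hc', smul_comm]

/-- The scalar `χ_i` by which `E*_0 τ_i(A)` acts on `E*_0 V`. -/
def chi (Φ : ParallelSystem 𝕜 V d) (h : Φ.IsSharp) (i : Fin (d + 1)) : 𝕜 :=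
  (Φ.exists_chi h i).choose

/-- The split sequence `ζ_i = (θ*_0 - θ*_1) (θ*_0 - θ*_2) ⋯ (θ*_0 - θ*_i) χ_i` of a sharp parallel
system. -/
def splitSequence (Φ : ParallelSystem 𝕜 V d) (h : Φ.IsSharp) (i : Fin (d + 1)) : 𝕜 :=
  (∏ j ∈ Finset.Ioc 0 i, (Φ.dualEigenvalue 0 - Φ.dualEigenvalue j)) * Φ.chi h i

/-- The parameter array `({θ_i}, {θ*_i}, {ζ_i})` of a sharp parallel system. -/
def parameterArray (Φ : ParallelSystem 𝕜 V d) (h : Φ.IsSharp) :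
    (Fin (d + 1) → 𝕜) × (Fin (d + 1) → 𝕜) × (Fin (d + 1) → 𝕜) :=
  (Φ.eigenvalue, Φ.dualEigenvalue, Φ.splitSequence h)

end ParallelSystem

variable (𝕜 V d) in
/-- A tridiagonal system on `V`. -/
structure TridiagonalSystem extends ParallelSystem 𝕜 V d where
  tridiag : ∀ i j : Fin (d + 1), 1 < |(i : ℤ) - (j : ℤ)| → E i * Astar * E j = 0
  tridiag_star : ∀ i j : Fin (d + 1), 1 < |(i : ℤ) - (j : ℤ)| → Estar i * A * Estar j = 0
  irreducible : ∀ W : Submodule 𝕜 V, W.map A ≤ W → W.map Astar ≤ W → W = ⊥ ∨ W = ⊤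

/-- The family `U_0, …, U_d` extended by `U_k = 0` for `k < 0` and `k > d`. -/
def extendByZero (U : Fin (d + 1) → Submodule 𝕜 V) (k : ℤ) : Submodule 𝕜 V :=
  ⨆ (j : Fin (d + 1)) (_ : (j : ℤ) = k), U j

/-- `{U_i}` is a decomposition of `V` (nonzero subspaces with direct sum `V`) that is split with
respect to `Φ`. -/
structure IsSplitDecomposition (Φ : TridiagonalSystem 𝕜 V d)
    (U : Fin (d + 1) → Submodule 𝕜 V) : Prop where
  ne_bot : ∀ i, U i ≠ ⊥
  isInternal : DirectSum.IsInternal U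
  raise : ∀ i, (U i).map (Φ.A - Φ.eigenvalue i • (1 : Module.End 𝕜 V)) ≤
    extendByZero U ((i : ℤ) + 1)
  lower : ∀ i, (U i).map (Φ.Astar - Φ.dualEigenvalue i • (1 : Module.End 𝕜 V)) ≤
    extendByZero U ((i : ℤ) - 1)

/-- `U_i` is the eigenspace of `K` for the eigenvalue `q^(d-2i)`, for `0 ≤ i ≤ d`. -/
def IsWeightMap (q : 𝕜) (U : Fin (d + 1) → Submodule 𝕜 V) (K : Module.End 𝕜 V) : Prop :=
  ∀ i : Fin (d + 1), K.eigenspace (q ^ ((d : ℤ) - 2 * (i : ℤ))) = U i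

/-- The parallel system `Φ'` is `(B; {E_i}; B*; {E'_i})`, where `B = A`, `B* = t A* + (1 - t) K`
and `E'_i` is the primitive idempotent of `B*` associated with the eigenvalue `θ*_i` of `A*`. -/
structure IsLinearPerturbation (Φ : TridiagonalSystem 𝕜 V d) (K : Module.End 𝕜 V) (t : 𝕜)
    (Φ' : ParallelSystem 𝕜 V d) : Prop where
  A_eq : Φ'.A = Φ.A
  E_eq : Φ'.E = Φ.E
  Astar_eq : Φ'.Astar = t • Φ.Astar + (1 - t) • K
  Estar_eq : Φ'.Estar =
    primitiveIdempotent (t • Φ.Astar + (1 - t) • K) Φ.dualEigenvalue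

end TridiagonalPerturbation

end

/-!
Sharpness is proved without the `q`-Serre relations. Because `θ_i = q ^ (2 i - d)`, the block
`E_i (∑ c_e A ^ e p(A*) A ^ (n - e)) E_k` is `θ_k ^ n ∑ c_e q ^ (2 e (i - k))` times
`E_i p(A*) E_k`, which vanishes for `|i - k| > deg p`. Hence every relation among the Laurent
monomials `x ^ e` at the `2 m + 1` points `q ^ (2 j)`, `|j| ≤ m`, is a relation among the maps
`A ^ e p(A*) A ^ (n - e)` with `deg p ≤ m` (`TridiagonalSystem.pow_mul_aeval_mul_pow`), and Lagrange
interpolation supplies such relations. Since `E*_a A ^ e E*_k = 0` for `e < |a - k|`, many terms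
drop out of a product `E*_a A ^ r E*_k A ^ s E*_b`, and downward induction on `k` gives two facts.

* A peak can be lowered: the product is a combination of products of the same form with `k` replaced
  by indices at most `(a + b) / 2` (`TridiagonalSystem.word_apply_mem`).
* For `a = b = 0` the product is symmetric in `r` and `s` (`TridiagonalSystem.word_apply_symm`); for
  `k = 0` this says that the maps `E*_0 A ^ r` commute on `E*_0 V`.

Let `v` be a common eigenvector of the maps `E*_0 A ^ r` on `E*_0 V`. By irreducibility `V` is
spanned by the vectors `E*_{k_l} A ^ {r_l} ⋯ E*_{k_1} A ^ {r_1} v`. Lowering peaks makes the index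
sequence `0, k_1, …, k_l` convex, so if `k_l = 0` all indices may be taken to be `0` and the vector is
a multiple of `v`. Therefore `E*_0 V` is the line through `v` (`TridiagonalSystem.isSharp`).

The split decomposition is `U_i = (E*_0 V + ⋯ + E*_i V) ∩ (E_i V + ⋯ + E_d V)`, by irreducibility. On
`U_i` the map `B* - θ*_i` is `t` times the lowering map `A* - θ*_i`, so `B*` is triangular with
eigenvalues `θ*_i`, and `E'_0 = t ^ i E*_0` on `U_i`
(`IsSplitDecomposition.perturbation_idempotent_apply`). As `τ_i(A)` sends `U_0 = E*_0 V` into `U_i`,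
the scalar `χ_i` is multiplied by `t ^ i`.
-/

noncomputable section

namespace TridiagonalPerturbation

variable {𝕜 V : Type*} [Field 𝕜] [AddCommGroup V] [Module 𝕜 V] {d : ℕ}

/-! ### Primitive idempotents -/

section Idempotents

theorem aeval_apply_of_eigen {A : Module.End 𝕜 V} {μ : 𝕜} {v : V} (h : A v = μ • v) (p : 𝕜[X]) :
    Polynomial.aeval A p v = p.eval μ • v := by
  induction p using Polynomial.induction_on' with
  | add p r hp hr => simp [hp, hr, add_smul]
  | monomial n a =>
    have : ∀ n : ℕ, (A ^ n) v = μ ^ n • v := by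
      intro n
      induction n with
      | zero => simp
      | succ n ih => rw [pow_succ', Module.End.mul_apply, ih, map_smul, h, smul_smul, pow_succ]
    simp [Polynomial.aeval_monomial, this, smul_smul, mul_comm]

/-- Linear maps that agree on the eigenvectors of a diagonalizable map are equal. -/
theorem IsDiagonalizable.ext {A : Module.End 𝕜 V} (hA : IsDiagonalizable A)
    {f g : Module.End 𝕜 V} (h : ∀ (μ : 𝕜) (v : V), A v = μ • v → v ≠ 0 → f v = g v) : f = g := by
  have : (⊤ : Submodule 𝕜 V) ≤ LinearMap.eqLocus f g := by
    rw [← hA]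
    refine iSup_le fun μ v hv => ?_
    by_cases hv0 : v = 0
    · simp [hv0]
    · exact h μ v (Module.End.mem_eigenspace_iff.mp hv) hv0
  exact LinearMap.ext fun v => this trivial

theorem primitiveIdempotent_apply_of_eigen {A : Module.End 𝕜 V} {θ : Fin (d + 1) → 𝕜}
    (hθ : Function.Injective θ) {i : Fin (d + 1)} {v : V} (h : A v = θ i • v)
    (j : Fin (d + 1)) : primitiveIdempotent A θ j v = if j = i then v else 0 := by
  rw [primitiveIdempotent, aeval_apply_of_eigen h]
  split_ifs with hij
  · subst hij
    rw [Lagrange.eval_basis_self hθ.injOn (Finset.mem_univ _), one_smul]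
  · rw [Lagrange.eval_basis_of_ne hij (Finset.mem_univ _), zero_smul]

variable {A : Module.End 𝕜 V} {E : Fin (d + 1) → Module.End 𝕜 V} {θ : Fin (d + 1) → 𝕜}

theorem IsIdempotentOrdering.apply_of_eigen (h : IsIdempotentOrdering A E θ) {i : Fin (d + 1)}
    {v : V} (hv : A v = θ i • v) (j : Fin (d + 1)) : E j v = if j = i then v else 0 := by
  rw [h.eq_primitiveIdempotent, primitiveIdempotent_apply_of_eigen h.injective hv]

theorem IsIdempotentOrdering.eigen_cases (h : IsIdempotentOrdering A E θ) {μ : 𝕜} {v : V}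
    (hv : A v = μ • v) (hv0 : v ≠ 0) : ∃ i, θ i = μ :=
  (h.hasEigenvalue_iff μ).mp
    (Module.End.hasEigenvalue_of_hasEigenvector ⟨Module.End.mem_eigenspace_iff.mpr hv, hv0⟩)

theorem IsIdempotentOrdering.aeval_eq_sum (h : IsIdempotentOrdering A E θ)
    (hA : IsDiagonalizable A) (p : 𝕜[X]) :
    Polynomial.aeval A p = ∑ i, p.eval (θ i) • E i := by
  refine hA.ext fun μ v hv hv0 => ?_
  obtain ⟨i, rfl⟩ := h.eigen_cases hv hv0
  simp [aeval_apply_of_eigen hv, LinearMap.sum_apply, h.apply_of_eigen hv]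

theorem IsIdempotentOrdering.sum_eq_one (h : IsIdempotentOrdering A E θ)
    (hA : IsDiagonalizable A) : ∑ i, E i = 1 := by
  have := h.aeval_eq_sum hA 1
  simpa using this.symm

theorem IsIdempotentOrdering.sum_apply (h : IsIdempotentOrdering A E θ)
    (hA : IsDiagonalizable A) (v : V) : ∑ i, E i v = v := by
  have := congrArg (fun f : Module.End 𝕜 V => f v) (h.sum_eq_one hA)
  simpa [LinearMap.sum_apply] using this

theorem IsIdempotentOrdering.mul_right (h : IsIdempotentOrdering A E θ)
    (hA : IsDiagonalizable A) (i : Fin (d + 1)) : A * E i = θ i • E i := by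
  refine hA.ext fun μ v hv hv0 => ?_
  obtain ⟨j, rfl⟩ := h.eigen_cases hv hv0
  rw [Module.End.mul_apply, LinearMap.smul_apply, h.apply_of_eigen hv]
  split_ifs with hij
  · rw [hv, hij]
  · simp

theorem IsIdempotentOrdering.mul_left (h : IsIdempotentOrdering A E θ)
    (hA : IsDiagonalizable A) (i : Fin (d + 1)) : E i * A = θ i • E i := by
  refine hA.ext fun μ v hv hv0 => ?_
  obtain ⟨j, rfl⟩ := h.eigen_cases hv hv0
  rw [Module.End.mul_apply, LinearMap.smul_apply, hv, map_smul, h.apply_of_eigen hv]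
  split_ifs with hij
  · rw [hij]
  · simp

theorem IsIdempotentOrdering.apply_apply (h : IsIdempotentOrdering A E θ)
    (hA : IsDiagonalizable A) (i : Fin (d + 1)) (v : V) : A (E i v) = θ i • E i v :=
  congrArg (fun f : Module.End 𝕜 V => f v) (h.mul_right hA i)

theorem IsIdempotentOrdering.apply_comm (h : IsIdempotentOrdering A E θ)
    (hA : IsDiagonalizable A) (i : Fin (d + 1)) (v : V) : E i (A v) = θ i • E i v :=
  congrArg (fun f : Module.End 𝕜 V => f v) (h.mul_left hA i)

theorem IsIdempotentOrdering.mul_pow_right (h : IsIdempotentOrdering A E θ)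
    (hA : IsDiagonalizable A) (i : Fin (d + 1)) (n : ℕ) : A ^ n * E i = θ i ^ n • E i := by
  induction n with
  | zero => simp
  | succ n ih =>
    rw [pow_succ, mul_assoc, h.mul_right hA, mul_smul_comm, ih, smul_smul, pow_succ']

theorem IsIdempotentOrdering.mul_pow_left (h : IsIdempotentOrdering A E θ)
    (hA : IsDiagonalizable A) (i : Fin (d + 1)) (n : ℕ) : E i * A ^ n = θ i ^ n • E i := by
  induction n with
  | zero => simp
  | succ n ih =>
    rw [pow_succ', ← mul_assoc, h.mul_left hA, smul_mul_assoc, ih, smul_smul, pow_succ']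

theorem IsIdempotentOrdering.idem (h : IsIdempotentOrdering A E θ)
    (hA : IsDiagonalizable A) (i j : Fin (d + 1)) (v : V) :
    E i (E j v) = if i = j then E j v else 0 :=
  h.apply_of_eigen (h.apply_apply hA j v) i

theorem IsIdempotentOrdering.exists_ne_zero (h : IsIdempotentOrdering A E θ) (i : Fin (d + 1)) :
    ∃ v, v ≠ 0 ∧ A v = θ i • v ∧ E i v = v := by
  obtain ⟨v, hv⟩ := ((h.hasEigenvalue_iff (θ i)).mpr ⟨i, rfl⟩).exists_hasEigenvector
  have := Module.End.mem_eigenspace_iff.mp hv.1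
  exact ⟨v, hv.2, this, by simp [h.apply_of_eigen this]⟩

theorem IsIdempotentOrdering.mem_range_iff (h : IsIdempotentOrdering A E θ)
    (hA : IsDiagonalizable A) {i : Fin (d + 1)} {v : V} :
    v ∈ LinearMap.range (E i) ↔ E i v = v := by
  constructor
  · rintro ⟨w, rfl⟩
    simp [h.idem hA]
  · exact fun hv => ⟨v, hv⟩

/-- The eigenvalue attached to an idempotent is determined by `A` and the idempotent. -/
theorem IsIdempotentOrdering.eigenvalue_unique {η : Fin (d + 1) → 𝕜}
    (h : IsIdempotentOrdering A E θ) (h' : IsIdempotentOrdering A E η)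
    (hA : IsDiagonalizable A) : θ = η := by
  funext i
  obtain ⟨v, hv0, hv, hEv⟩ := h.exists_ne_zero i
  have h1 := h'.apply_apply hA i v
  rw [hEv, hv] at h1
  exact smul_left_injective 𝕜 hv0 h1

/-- If `X` is tridiagonal with respect to the idempotents `E i`, then `X ^ m` has bandwidth `m`. -/
theorem IsIdempotentOrdering.band_pow (h : IsIdempotentOrdering A E θ) (hA : IsDiagonalizable A)
    {X : Module.End 𝕜 V}
    (hX : ∀ i j : Fin (d + 1), 1 < |(i : ℤ) - (j : ℤ)| → E i * X * E j = 0) (m : ℕ) :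
    ∀ i j : Fin (d + 1), (m : ℤ) < |(i : ℤ) - (j : ℤ)| → E i * X ^ m * E j = 0 := by
  induction m with
  | zero =>
    intro i j hij
    have hne : i ≠ j := by rintro rfl; simp at hij
    ext v
    simp [h.idem hA, hne]
  | succ m ih =>
    intro i j hij
    have : E i * X ^ (m + 1) * E j = ∑ k, (E i * X) * E k * (X ^ m * E j) := by
      rw [← Finset.sum_mul, ← Finset.mul_sum, h.sum_eq_one hA, mul_one, pow_succ']
      simp only [mul_assoc]
    rw [this]
    refine Finset.sum_eq_zero fun k _ => ?_
    by_cases hik : 1 < |(i : ℤ) - (k : ℤ)|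
    · rw [hX i k hik, zero_mul]
    · have hkj : (m : ℤ) < |(k : ℤ) - (j : ℤ)| := by
        have := abs_sub_le (i : ℤ) k j
        push_cast at hij
        omega
      have hidem : E k = E k * E k := by
        ext v
        simp [h.idem hA]
      rw [hidem, mul_assoc (E i * X), mul_assoc (E k), ← mul_assoc (E k) (X ^ m), ih k j hkj,
        mul_zero, mul_zero]

theorem IsIdempotentOrdering.band_aeval (h : IsIdempotentOrdering A E θ) (hA : IsDiagonalizable A)
    {X : Module.End 𝕜 V}
    (hX : ∀ i j : Fin (d + 1), 1 < |(i : ℤ) - (j : ℤ)| → E i * X * E j = 0) (p : 𝕜[X])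
    (i j : Fin (d + 1)) (hp : (p.natDegree : ℤ) < |(i : ℤ) - (j : ℤ)|) :
    E i * Polynomial.aeval X p * E j = 0 := by
  rw [Polynomial.aeval_eq_sum_range, Finset.mul_sum, Finset.sum_mul]
  refine Finset.sum_eq_zero fun k hk => ?_
  rw [mul_smul_comm, smul_mul_assoc, h.band_pow hA hX k i j, smul_zero]
  have := Finset.mem_range.mp hk
  omega

end Idempotents

/-! ### Consequences of the tridiagonal relations for geometric eigenvalues -/

/-- Lagrange interpolation of the Laurent monomials `x ^ j`, `|j| ≤ m`, at `2 * m + 1` or more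
nodes. -/
theorem zpow_eq_sum_lagrange {s : Finset ℕ} {z : ℕ → 𝕜} (hz : Set.InjOn z s)
    (hz0 : ∀ e, z e ≠ 0) {m : ℕ} (hm : 2 * m + 1 ≤ s.card) {x : 𝕜} (hx : x ≠ 0) {j : ℤ}
    (hj : |j| ≤ m) :
    x ^ j = ∑ e ∈ s, ((Lagrange.basis s z e).eval x * (z e / x) ^ m) * z e ^ j := by
  obtain ⟨n, hn⟩ : ∃ n : ℕ, (n : ℤ) = j + m := ⟨(j + m).toNat, by
    have := neg_abs_le j
    omega⟩
  have hnm : n < s.card := by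
    have := le_abs_self j
    omega
  have hpow : ∀ y : 𝕜, y ≠ 0 → y ^ j = y ^ n / y ^ m := by
    intro y hy
    rw [eq_div_iff (pow_ne_zero _ hy), ← zpow_natCast y m, ← zpow_add₀ hy, ← hn, zpow_natCast]
  have key := Lagrange.eq_interpolate (f := (Polynomial.X ^ n : 𝕜[X])) hz
    (lt_of_le_of_lt (Polynomial.degree_X_pow_le n) (by exact_mod_cast hnm))
  have key2 := congrArg (Polynomial.eval x) key
  rw [Lagrange.interpolate_apply, Polynomial.eval_finsetSum] at key2
  simp only [Polynomial.eval_pow, Polynomial.eval_X, Polynomial.eval_mul,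
    Polynomial.eval_C] at key2
  rw [hpow x hx, key2, Finset.sum_div]
  refine Finset.sum_congr rfl fun e _ => ?_
  rw [hpow _ (hz0 e), div_pow]
  have h1 := pow_ne_zero m (hz0 e)
  have h2 := pow_ne_zero m hx
  field_simp

theorem injective_pow_sq {q : 𝕜} (hq0 : q ≠ 0) (hq : ∀ n : ℕ, 0 < n → q ^ n ≠ 1) :
    Function.Injective fun e : ℕ => (q ^ 2) ^ e := by
  have key : ∀ e f : ℕ, e ≤ f → (q ^ 2) ^ e = (q ^ 2) ^ f → e = f := by
    intro e f hef h
    by_contra hne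
    obtain ⟨g, rfl⟩ := Nat.exists_eq_add_of_le hef
    rw [pow_add, left_eq_mul₀ (pow_ne_zero _ (pow_ne_zero _ hq0)), ← pow_mul] at h
    exact hq (2 * g) (by omega) h
  intro e f h
  rcases le_total e f with hef | hef
  · exact key e f hef h
  · exact (key f e hef h.symm).symm

section Words

variable (Φ : TridiagonalSystem 𝕜 V d)

theorem TridiagonalSystem.ordering_spec :
    IsIdempotentOrdering Φ.A Φ.E Φ.eigenvalue := Φ.ordering.choose_spec

theorem TridiagonalSystem.ordering_star_spec :
    IsIdempotentOrdering Φ.Astar Φ.Estar Φ.dualEigenvalue := Φ.ordering_star.choose_spec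

/-- If the monomial `x ^ r` agrees with `∑ c_e x ^ e` at the points `q ^ (2 j)`, `|j| ≤ m`, then
`A ^ r p(A*) A ^ (n - r)` equals `∑ c_e A ^ e p(A*) A ^ (n - e)` whenever `deg p ≤ m`: the
`(i, k)` block `E_i p(A*) E_k` vanishes unless `|i - k| ≤ m`, and on it the two sides act as
`θ_k ^ n` times the values at `q ^ (2 (i - k))`. -/
theorem TridiagonalSystem.pow_mul_aeval_mul_pow {q : 𝕜} (hq0 : q ≠ 0)
    (hθ : ∀ i : Fin (d + 1), Φ.eigenvalue i = q ^ (2 * (i : ℤ) - (d : ℤ)))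
    {n m r : ℕ} (hr : r ≤ n) {s : Finset ℕ} (hs : ∀ e ∈ s, e ≤ n) {c : ℕ → 𝕜}
    (hc : ∀ j : ℤ, |j| ≤ m → ((q ^ 2) ^ r) ^ j = ∑ e ∈ s, c e * ((q ^ 2) ^ e) ^ j)
    {p : 𝕜[X]} (hp : p.natDegree ≤ m) :
    Φ.A ^ r * Polynomial.aeval Φ.Astar p * Φ.A ^ (n - r) =
      ∑ e ∈ s, c e • (Φ.A ^ e * Polynomial.aeval Φ.Astar p * Φ.A ^ (n - e)) := by
  have hE := Φ.ordering_spec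
  have hA := Φ.diag
  set T := Polynomial.aeval Φ.Astar p with hT
  have hsand : ∀ (i k : Fin (d + 1)) (e f : ℕ), Φ.E i * (Φ.A ^ e * T * Φ.A ^ f) * Φ.E k =
      (Φ.eigenvalue i ^ e * Φ.eigenvalue k ^ f) • (Φ.E i * T * Φ.E k) := by
    intro i k e f
    calc Φ.E i * (Φ.A ^ e * T * Φ.A ^ f) * Φ.E k
        = (Φ.E i * Φ.A ^ e) * T * (Φ.A ^ f * Φ.E k) := by simp only [mul_assoc]
      _ = _ := by
        rw [hE.mul_pow_left hA, hE.mul_pow_right hA]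
        simp only [smul_mul_assoc, mul_smul_comm, smul_smul, mul_comm]
  have hval : ∀ (i k : Fin (d + 1)) (e : ℕ), e ≤ n →
      Φ.eigenvalue i ^ e * Φ.eigenvalue k ^ (n - e) =
        Φ.eigenvalue k ^ n * ((q ^ 2) ^ e) ^ ((i : ℤ) - (k : ℤ)) := by
    intro i k e he
    have hik : Φ.eigenvalue i = Φ.eigenvalue k * (q ^ 2) ^ ((i : ℤ) - (k : ℤ)) := by
      rw [hθ, hθ, ← zpow_natCast q 2, ← zpow_mul, ← zpow_add₀ hq0]
      congr 1
      push_cast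
      ring
    have hcomm : ((q ^ 2) ^ ((i : ℤ) - (k : ℤ))) ^ e = ((q ^ 2) ^ e) ^ ((i : ℤ) - (k : ℤ)) := by
      rw [← zpow_natCast _ e, ← zpow_natCast _ e, ← zpow_mul, ← zpow_mul, mul_comm]
    rw [hik, mul_pow, mul_right_comm, ← pow_add, Nat.add_sub_cancel' he, hcomm]
  have hblock : ∀ i k : Fin (d + 1),
      Φ.E i * (Φ.A ^ r * T * Φ.A ^ (n - r)) * Φ.E k =
        Φ.E i * (∑ e ∈ s, c e • (Φ.A ^ e * T * Φ.A ^ (n - e))) * Φ.E k := by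
    intro i k
    rw [Finset.mul_sum, Finset.sum_mul]
    simp only [mul_smul_comm, smul_mul_assoc, hsand, smul_smul]
    rw [← Finset.sum_smul]
    by_cases hik : |(i : ℤ) - (k : ℤ)| ≤ m
    · congr 1
      rw [hval i k r hr, hc _ hik, Finset.mul_sum]
      refine Finset.sum_congr rfl fun e he => ?_
      rw [hval i k e (hs e he)]
      ring
    · rw [hT, hE.band_aeval hA Φ.tridiag p i k (by omega), smul_zero, smul_zero]
  have hexp : ∀ X : Module.End 𝕜 V, X = ∑ i, ∑ k, Φ.E i * X * Φ.E k := by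
    intro X
    simp only [← Finset.mul_sum, ← Finset.sum_mul]
    rw [hE.sum_eq_one hA, one_mul, mul_one]
  rw [hexp (Φ.A ^ r * T * Φ.A ^ (n - r)), hexp (∑ e ∈ s, _)]
  exact Finset.sum_congr rfl fun i _ => Finset.sum_congr rfl fun k _ => hblock i k

/-- The product `E*_a A^r E*_k A^s`. -/
def TridiagonalSystem.word (a : Fin (d + 1)) (r : ℕ) (k : Fin (d + 1)) (s : ℕ) :
    Module.End 𝕜 V :=
  Φ.Estar a * Φ.A ^ r * Φ.Estar k * Φ.A ^ s

theorem TridiagonalSystem.word_eq_zero_left {a k : Fin (d + 1)} {r : ℕ} (s : ℕ)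
    (h : (r : ℤ) < |(a : ℤ) - (k : ℤ)|) : Φ.word a r k s = 0 := by
  rw [word, Φ.ordering_star_spec.band_pow Φ.diag_star Φ.tridiag_star r a k h, zero_mul]

theorem TridiagonalSystem.word_apply_eq_zero_right {a b k : Fin (d + 1)} (r : ℕ) {s : ℕ} {u : V}
    (hu : Φ.Estar b u = u) (h : (s : ℤ) < |(k : ℤ) - (b : ℤ)|) : Φ.word a r k s u = 0 := by
  have := congrArg (fun f : Module.End 𝕜 V => f u)
    (Φ.ordering_star_spec.band_pow Φ.diag_star Φ.tridiag_star s k b h)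
  simp only [Module.End.mul_apply, LinearMap.zero_apply] at this
  rw [hu] at this
  simp [word, Module.End.mul_apply, this]

/-- The relation `pow_mul_aeval_mul_pow` with `p(A*)` expanded in the idempotents `E*_j`, for the
coefficients given by Lagrange interpolation. -/
theorem TridiagonalSystem.sum_word_apply {q : 𝕜} (hq0 : q ≠ 0) (hq : ∀ n : ℕ, 0 < n → q ^ n ≠ 1)
    (hθ : ∀ i : Fin (d + 1), Φ.eigenvalue i = q ^ (2 * (i : ℤ) - (d : ℤ)))
    {n m r : ℕ} (hr : r ≤ n) {s : Finset ℕ} (hs : ∀ e ∈ s, e ≤ n) (hm : 2 * m + 1 ≤ s.card)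
    {p : 𝕜[X]} (hp : p.natDegree ≤ m) (a : Fin (d + 1)) (u : V) :
    ∑ j, p.eval (Φ.dualEigenvalue j) • Φ.word a r j (n - r) u =
      ∑ e ∈ s, ((Lagrange.basis s (fun e : ℕ => (q ^ 2) ^ e) e).eval ((q ^ 2) ^ r) *
        ((q ^ 2) ^ e / (q ^ 2) ^ r) ^ m) •
          ∑ j, p.eval (Φ.dualEigenvalue j) • Φ.word a e j (n - e) u := by
  have hinj : Function.Injective fun e : ℕ => (q ^ 2) ^ e :=
    injective_pow_sq hq0 hq
  have hne : ∀ e : ℕ, (q ^ 2) ^ e ≠ 0 := fun e => pow_ne_zero _ (pow_ne_zero _ hq0)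
  have key := Φ.pow_mul_aeval_mul_pow hq0 hθ hr hs
    (fun j hj => zpow_eq_sum_lagrange hinj.injOn hne hm (hne r) hj) hp
  have hword : ∀ e f : ℕ, ∑ j, p.eval (Φ.dualEigenvalue j) • Φ.word a e j f u =
      Φ.Estar a ((Φ.A ^ e * Polynomial.aeval Φ.Astar p * Φ.A ^ f) u) := by
    intro e f
    rw [Φ.ordering_star_spec.aeval_eq_sum Φ.diag_star]
    simp [word, Module.End.mul_apply, LinearMap.sum_apply, map_sum]
  simp only [hword]
  rw [key]
  simp only [LinearMap.sum_apply, map_sum, LinearMap.smul_apply, map_smul]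

end Words

/-! ### Elimination of peaks and commutativity -/

section Peaks

variable (Φ : TridiagonalSystem 𝕜 V d)

/-- The exponents `e` with `e < f` or `n - e < g`. For `f = k - a` and `g = k - b`, truncated at
zero, these are exponents for which `E*_a A^e E*_k A^(n-e) E*_b` vanishes because the powers of `A`
are too low. -/
def deadExponents (n f g : ℕ) : Finset ℕ :=
  Finset.range f ∪ (Finset.range g).image (n - ·)

theorem mem_deadExponents {n f g e : ℕ} :
    e ∈ deadExponents n f g ↔ e < f ∨ ∃ i < g, n - i = e := by
  simp [deadExponents]

theorem disjoint_dead {n f g r : ℕ} (hf : f ≤ r) (hg : r + g ≤ n) :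
    Disjoint (Finset.range f) ((Finset.range g).image (n - ·)) := by
  rw [Finset.disjoint_left]
  intro e he he'
  obtain ⟨i, hi, rfl⟩ := Finset.mem_image.mp he'
  simp only [Finset.mem_range] at he hi
  omega

theorem injOn_sub {n g : ℕ} (hg : g ≤ n) : Set.InjOn (n - ·) (Finset.range g : Set ℕ) := by
  intro i hi j hj hij
  simp only [Finset.coe_range, Set.mem_Iio] at hi hj hij
  omega

theorem card_deadExponents {n f g r : ℕ} (hf : f ≤ r) (hg : r + g ≤ n) :
    (deadExponents n f g).card = f + g := by
  rw [deadExponents, Finset.card_union_of_disjoint (disjoint_dead hf hg),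
    Finset.card_image_of_injOn (injOn_sub (by omega)), Finset.card_range, Finset.card_range]

theorem TridiagonalSystem.word_apply_eq_zero_of_dead {a b k j : Fin (d + 1)} {n e : ℕ} {u : V}
    (hu : Φ.Estar b u = u) (hkj : k ≤ j) (hb : (k : ℕ) - b ≤ n)
    (he : e ∈ deadExponents n (k - a) (k - b)) : Φ.word a e j (n - e) u = 0 := by
  have hkj' : (k : ℕ) ≤ j := hkj
  rcases mem_deadExponents.mp he with he | ⟨i, hi, rfl⟩
  · rw [Φ.word_eq_zero_left, LinearMap.zero_apply]
    have := neg_abs_le ((a : ℤ) - (j : ℤ))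
    omega
  · refine Φ.word_apply_eq_zero_right _ hu ?_
    have := le_abs_self ((j : ℤ) - (b : ℤ))
    omega

/-- Peak elimination: a middle index `k` above the mean of `a` and `b` can be lowered to indices
that do not exceed any `c ≥ (a + b - 1) / 2`. With `m = k - c - 1` there are at least `2 m + 1` dead
exponents, enough to interpolate `x^r`; the polynomial `p` of degree at most `m` removes the indices
between `c` and `k`, and those above `k` are covered by the induction. -/
theorem TridiagonalSystem.word_apply_mem {q : 𝕜} (hq0 : q ≠ 0) (hq : ∀ n : ℕ, 0 < n → q ^ n ≠ 1)
    (hθ : ∀ i : Fin (d + 1), Φ.eigenvalue i = q ^ (2 * (i : ℤ) - (d : ℤ)))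
    {a b : Fin (d + 1)} {c : ℕ} (hc : (a : ℕ) + b ≤ 2 * c + 1) {u : V} (hu : Φ.Estar b u = u)
    {S : Submodule 𝕜 V}
    (hS : ∀ j : Fin (d + 1), (j : ℕ) ≤ c → ∀ r s : ℕ, Φ.word a r j s u ∈ S)
    (k : Fin (d + 1)) (r s : ℕ) : Φ.word a r k s u ∈ S := by
  obtain ⟨n, hn⟩ : ∃ n, n = r + s := ⟨_, rfl⟩
  obtain rfl : s = n - r := by omega
  have hr : r ≤ n := by omega
  clear hn
  induction hk : d - (k : ℕ) using Nat.strong_induction_on generalizing k r with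
  | _ N ih =>
    have hd := k.isLt
    by_cases hkc : (k : ℕ) ≤ c
    · exact hS k hkc _ _
    by_cases hra : r < (k : ℕ) - a
    · rw [Φ.word_eq_zero_left]
      · exact S.zero_mem
      · have := neg_abs_le ((a : ℤ) - (k : ℤ))
        omega
    by_cases hrb : n - r < (k : ℕ) - b
    · rw [Φ.word_apply_eq_zero_right _ hu]
      · exact S.zero_mem
      · have := le_abs_self ((k : ℤ) - (b : ℤ))
        omega
    have hinj := Φ.ordering_star_spec.injective
    -- `p` removes the indices strictly between `c` and `k`.
    set I : Finset (Fin (d + 1)) := Finset.univ.filter fun j => c < (j : ℕ) ∧ j < k with hI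
    set p : 𝕜[X] := ∏ j ∈ I, (Polynomial.X - Polynomial.C (Φ.dualEigenvalue j)) with hp
    have hIcard : I.card ≤ (k : ℕ) - c - 1 := by
      rw [← Nat.card_Ioo]
      refine Finset.card_le_card_of_injOn (fun j => (j : ℕ)) ?_ Fin.val_injective.injOn
      intro j hj
      have := (Finset.mem_filter.mp hj).2
      exact Finset.mem_coe.mpr (Finset.mem_Ioo.mpr ⟨this.1, this.2⟩)
    have hpdeg : p.natDegree ≤ (k : ℕ) - c - 1 := by
      rw [hp, Polynomial.natDegree_prod_of_monic _ _ fun j _ => Polynomial.monic_X_sub_C _]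
      simpa using hIcard
    have hpk : p.eval (Φ.dualEigenvalue k) ≠ 0 := by
      rw [hp, Polynomial.eval_prod, Finset.prod_ne_zero_iff]
      intro j hj
      have hjk := (Finset.mem_filter.mp hj).2.2
      simpa [sub_eq_zero] using hinj.ne hjk.ne'
    have hpj : ∀ j : Fin (d + 1), c < (j : ℕ) → j < k → p.eval (Φ.dualEigenvalue j) = 0 := by
      intro j h1 h2
      rw [hp, Polynomial.eval_prod]
      exact Finset.prod_eq_zero (i := j) (by simp [hI, h1, h2]) (by simp)
    have hsum := Φ.sum_word_apply hq0 hq hθ hr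
      (s := deadExponents n (k - a) (k - b)) (by
        intro e he
        rcases mem_deadExponents.mp he with he | ⟨i, hi, rfl⟩ <;> omega)
      (by rw [card_deadExponents (r := r)] <;> omega) hpdeg a u
    have hrest : ∀ e ≤ n, ∀ j ≠ k, p.eval (Φ.dualEigenvalue j) • Φ.word a e j (n - e) u ∈ S := by
      intro e he j hjk
      rcases lt_or_gt_of_ne hjk with hlt | hgt
      · by_cases hjc : (j : ℕ) ≤ c
        · exact S.smul_mem _ (hS j hjc _ _)
        · rw [hpj j (by omega) hlt, zero_smul]
          exact S.zero_mem
      · have hgt' : (k : ℕ) < j := hgt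
        have := j.isLt
        exact S.smul_mem _ (ih (d - j) (by omega) j e he rfl)
    have hmem : p.eval (Φ.dualEigenvalue k) • Φ.word a r k (n - r) u ∈ S := by
      rw [← Finset.add_sum_erase _ _ (Finset.mem_univ k)] at hsum
      rw [← Submodule.add_mem_iff_left S (Submodule.sum_mem S fun j hj =>
        hrest r hr j (Finset.ne_of_mem_erase hj)), hsum]
      refine Submodule.sum_mem S fun e he => S.smul_mem _ (Submodule.sum_mem S fun j _ => ?_)
      by_cases hjk : j = k
      · subst hjk
        rw [Φ.word_apply_eq_zero_of_dead hu le_rfl (by omega) he, smul_zero]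
        exact S.zero_mem
      · refine hrest e ?_ j hjk
        rcases mem_deadExponents.mp he with he | ⟨i, hi, rfl⟩ <;> omega
    exact (Submodule.smul_mem_iff S hpk).mp hmem

/-- At the node `q ^ (2 s)` with `r + s = n`, the Lagrange coefficient of the node `q ^ (2 r)` is
one when the other nodes are placed symmetrically under `e ↦ n - e`. -/
theorem lagrange_coeff_symm {q : 𝕜} (hq0 : q ≠ 0) (hq : ∀ n : ℕ, 0 < n → q ^ n ≠ 1)
    {n k r : ℕ} (hr : k ≤ r) (hrn : r + k ≤ n) :
    (Lagrange.basis (insert r (deadExponents n k k)) (fun e : ℕ => (q ^ 2) ^ e) r).eval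
      ((q ^ 2) ^ (n - r)) * ((q ^ 2) ^ r / (q ^ 2) ^ (n - r)) ^ k = 1 := by
  have hx0 : q ^ 2 ≠ 0 := pow_ne_zero _ hq0
  have hinj := injective_pow_sq hq0 hq
  generalize q ^ 2 = x at hx0 hinj
  have hr' : r ∉ deadExponents n k k := by
    rw [mem_deadExponents]
    rintro (h | ⟨i, hi, h⟩) <;> omega
  rw [Lagrange.basis, Finset.erase_insert hr', Polynomial.eval_prod, deadExponents,
    Finset.prod_union (disjoint_dead hr hrn), Finset.prod_image (injOn_sub (by omega)),
    ← Finset.prod_mul_distrib]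
  have hpair : ∀ i ∈ Finset.range k,
      (Lagrange.basisDivisor (x ^ r) (x ^ i)).eval (x ^ (n - r)) *
        (Lagrange.basisDivisor (x ^ r) (x ^ (n - i))).eval (x ^ (n - r)) =
          x ^ (n - r) / x ^ r := by
    intro i hi
    have hik := Finset.mem_range.mp hi
    have h1 : x ^ r - x ^ i ≠ 0 := sub_ne_zero.mpr (hinj.ne (by omega))
    have h2 : x ^ r - x ^ (n - i) ≠ 0 := sub_ne_zero.mpr (hinj.ne (by omega))
    have e1 : x ^ (n - r) * x ^ r = x ^ (n - i) * x ^ i := by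
      rw [← pow_add, ← pow_add]
      congr 1
      omega
    simp only [Lagrange.basisDivisor, Polynomial.eval_mul, Polynomial.eval_C,
      Polynomial.eval_sub, Polynomial.eval_X]
    have h3 : x ^ r ≠ 0 := pow_ne_zero _ hx0
    field_simp
    linear_combination (x ^ (n - r) - x ^ r) * e1
  rw [Finset.prod_congr rfl hpair, Finset.prod_const, Finset.card_range, ← mul_pow]
  have h3 : x ^ r ≠ 0 := pow_ne_zero _ hx0
  have h4 : x ^ (n - r) ≠ 0 := pow_ne_zero _ hx0
  rw [div_mul_div_comm, mul_comm, div_self (mul_ne_zero h3 h4), one_pow]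

/-- On `E*_0 V` the map `E*_0 A^r E*_k A^s` is symmetric in `r` and `s`: the monomial `x^s` is
interpolated at the dead exponents and `r`, where the coefficient of `x^r` is one. -/
theorem TridiagonalSystem.word_apply_symm {q : 𝕜} (hq0 : q ≠ 0)
    (hq : ∀ n : ℕ, 0 < n → q ^ n ≠ 1)
    (hθ : ∀ i : Fin (d + 1), Φ.eigenvalue i = q ^ (2 * (i : ℤ) - (d : ℤ)))
    {u : V} (hu : Φ.Estar 0 u = u) (k : Fin (d + 1)) (r s : ℕ) :
    Φ.word 0 r k s u = Φ.word 0 s k r u := by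
  obtain ⟨n, hn⟩ : ∃ n, n = r + s := ⟨_, rfl⟩
  have hs : s = n - r := by omega
  have hr : r ≤ n := by omega
  clear hn
  induction hk : d - (k : ℕ) using Nat.strong_induction_on generalizing k r s with
  | _ N ih =>
    have hd := k.isLt
    have hzero_left : ∀ {r : ℕ} (s : ℕ), r < (k : ℕ) → Φ.word 0 r k s u = 0 := by
      intro r s h
      rw [Φ.word_eq_zero_left, LinearMap.zero_apply]
      have := neg_abs_le (((0 : Fin (d + 1)) : ℤ) - (k : ℤ))
      simp at this ⊢
      omega
    have hzero_right : ∀ (r : ℕ) {s : ℕ}, s < (k : ℕ) → Φ.word 0 r k s u = 0 := by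
      intro r s h
      refine Φ.word_apply_eq_zero_right _ hu ?_
      simpa using h
    by_cases hrk : r < (k : ℕ)
    · rw [hzero_left s hrk, hzero_right s hrk]
    by_cases hsk : s < (k : ℕ)
    · rw [hzero_left r hsk, hzero_right r hsk]
    by_cases hrs : r = s
    · rw [hrs]
    have hinj := Φ.ordering_star_spec.injective
    -- `p` removes the indices below `k`.
    set p : 𝕜[X] :=
      ∏ j ∈ Finset.Iio k, (Polynomial.X - Polynomial.C (Φ.dualEigenvalue j)) with hp
    have hpdeg : p.natDegree ≤ (k : ℕ) := by
      rw [hp, Polynomial.natDegree_prod_of_monic _ _ fun j _ => Polynomial.monic_X_sub_C _]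
      simp
    have hpk : p.eval (Φ.dualEigenvalue k) ≠ 0 := by
      rw [hp, Polynomial.eval_prod, Finset.prod_ne_zero_iff]
      intro j hj
      simpa [sub_eq_zero] using hinj.ne (Finset.mem_Iio.mp hj).ne'
    have hpj : ∀ j < k, p.eval (Φ.dualEigenvalue j) = 0 := by
      intro j h2
      rw [hp, Polynomial.eval_prod]
      exact Finset.prod_eq_zero (Finset.mem_Iio.mpr h2) (by simp)
    have hr' : r ∉ deadExponents n k k := by
      rw [mem_deadExponents]
      rintro (h | ⟨i, hi, h⟩) <;> omega
    have hdead : ∀ e ∈ deadExponents n k k, e ≤ n := by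
      intro e he
      rcases mem_deadExponents.mp he with he | ⟨i, hi, rfl⟩ <;> omega
    have hsum := Φ.sum_word_apply hq0 hq hθ (r := s) (n := n) (by omega)
      (s := insert r (deadExponents n k k)) (by
        intro e he
        rcases Finset.mem_insert.mp he with rfl | he
        · exact hr
        · exact hdead e he)
      (by
        rw [Finset.card_insert_of_notMem hr', card_deadExponents (r := r)] <;> omega) hpdeg 0 u
    rw [Finset.sum_insert hr'] at hsum
    have hcoef := lagrange_coeff_symm hq0 hq (n := n) (k := k) (r := r) (by omega) (by omega)
    rw [← hs] at hcoef
    rw [hcoef, one_smul, Finset.sum_eq_zero (s := deadExponents n k k), add_zero,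
      show n - s = r by omega, ← hs] at hsum
    · rw [← Finset.add_sum_erase _ _ (Finset.mem_univ k),
        ← Finset.add_sum_erase _ (fun j => p.eval (Φ.dualEigenvalue j) • Φ.word 0 r j s u)
          (Finset.mem_univ k)] at hsum
      have hrest : ∑ j ∈ Finset.univ.erase k,
          p.eval (Φ.dualEigenvalue j) • Φ.word 0 s j r u =
          ∑ j ∈ Finset.univ.erase k, p.eval (Φ.dualEigenvalue j) • Φ.word 0 r j s u := by
        refine Finset.sum_congr rfl fun j hj => ?_
        rcases lt_or_gt_of_ne (Finset.ne_of_mem_erase hj) with hlt | hgt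
        · rw [hpj j hlt, zero_smul, zero_smul]
        · have hgt' : (k : ℕ) < j := hgt
          have := j.isLt
          rw [ih (d - j) (by omega) j r s hs hr rfl]
      rw [hrest] at hsum
      exact (smul_right_injective V hpk (add_right_cancel hsum)).symm
    · intro e he
      rw [Finset.sum_eq_zero, smul_zero]
      intro j _
      rcases lt_or_ge j k with hlt | hge
      · rw [hpj j hlt, zero_smul]
      · rw [Φ.word_apply_eq_zero_of_dead (a := 0) hu hge (by simp; omega) (by simpa using he),
          smul_zero]

end Peaks

/-! ### Sharpness -/

section Sharp

variable (Φ : TridiagonalSystem 𝕜 V d)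

/-- The algebraically closed field enters here only: the maps `E*_0 A^r` on `E*_0 V` commute, so
they have a common eigenvector. -/
theorem TridiagonalSystem.exists_common_eigenvector [IsAlgClosed 𝕜] [FiniteDimensional 𝕜 V]
    {q : 𝕜} (hq0 : q ≠ 0) (hq : ∀ n : ℕ, 0 < n → q ^ n ≠ 1)
    (hθ : ∀ i : Fin (d + 1), Φ.eigenvalue i = q ^ (2 * (i : ℤ) - (d : ℤ))) :
    ∃ v, v ≠ 0 ∧ Φ.Estar 0 v = v ∧ ∀ r : ℕ, ∃ μ : 𝕜, (Φ.Estar 0 * Φ.A ^ r) v = μ • v := by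
  have hE := Φ.ordering_star_spec
  have hA := Φ.diag_star
  let C : Set (Submodule 𝕜 V) := {W | W ≠ ⊥ ∧ (∀ v ∈ W, Φ.Estar 0 v = v) ∧
    ∀ r : ℕ, ∀ v ∈ W, (Φ.Estar 0 * Φ.A ^ r) v ∈ W}
  have hC : C.Nonempty := by
    refine ⟨LinearMap.range (Φ.Estar 0), ?_, fun v hv => (hE.mem_range_iff hA).mp hv,
      fun r v _ => ⟨_, rfl⟩⟩
    obtain ⟨v, hv0, -, hv⟩ := hE.exists_ne_zero 0
    exact (Submodule.ne_bot_iff _).mpr ⟨v, (hE.mem_range_iff hA).mpr hv, hv0⟩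
  -- On a minimal invariant subspace each of the maps is a scalar.
  obtain ⟨W, ⟨hW0, hWE, hWinv⟩, hmin⟩ := IsArtinian.set_has_minimal C hC
  obtain ⟨v, hvW, hv0⟩ := (Submodule.ne_bot_iff _).mp hW0
  refine ⟨v, hv0, hWE v hvW, fun r => ?_⟩
  have : Nontrivial W := ⟨⟨⟨v, hvW⟩, 0, fun h => hv0 (congrArg Subtype.val h)⟩⟩
  obtain ⟨μ, hμ⟩ := Module.End.exists_eigenvalue ((Φ.Estar 0 * Φ.A ^ r).restrict (hWinv r))
  obtain ⟨w, hw⟩ := hμ.exists_hasEigenvector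
  have hw' : (Φ.Estar 0 * Φ.A ^ r) w = μ • (w : V) :=
    congrArg Subtype.val (Module.End.mem_eigenspace_iff.mp hw.1)
  have hmem : W ⊓ (Φ.Estar 0 * Φ.A ^ r).eigenspace μ ∈ C := by
    refine ⟨(Submodule.ne_bot_iff _).mpr ⟨w, ⟨w.2, Module.End.mem_eigenspace_iff.mpr hw'⟩,
      fun h => hw.2 (Subtype.ext h)⟩, fun v hv => hWE v hv.1, fun s x hx =>
        ⟨hWinv s x hx.1, Module.End.mem_eigenspace_iff.mpr ?_⟩⟩
    rw [← map_smul, ← Module.End.mem_eigenspace_iff.mp hx.2]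
    have := Φ.word_apply_symm hq0 hq hθ (hWE x hx.1) 0 r s
    simpa [TridiagonalSystem.word, Module.End.mul_apply] using this
  have hle : W ≤ (Φ.Estar 0 * Φ.A ^ r).eigenspace μ := by
    by_contra hnot
    exact hmin _ hmem (lt_of_le_of_ne inf_le_left fun h => hnot (h ▸ inf_le_right))
  exact ⟨μ, Module.End.mem_eigenspace_iff.mp (hle hvW)⟩

/-- The span of the vectors `E*_{k_l} A^{r_l} ⋯ E*_{k_1} A^{r_1} v` with `k_l = b`. -/
def TridiagonalSystem.reach (v : V) : ℕ → Fin (d + 1) → Submodule 𝕜 V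
  | 0, b => if b = 0 then 𝕜 ∙ v else ⊥
  | l + 1, b => ⨆ (a : Fin (d + 1)) (r : ℕ), (reach v l a).map (Φ.Estar b * Φ.A ^ r)

variable {Φ}

theorem TridiagonalSystem.mem_reach_succ {v w : V} {l : ℕ} {a : Fin (d + 1)}
    (hw : w ∈ Φ.reach v l a) (b : Fin (d + 1)) (r : ℕ) :
    (Φ.Estar b * Φ.A ^ r) w ∈ Φ.reach v (l + 1) b :=
  Submodule.mem_iSup_of_mem a (Submodule.mem_iSup_of_mem r ⟨w, hw, rfl⟩)

theorem TridiagonalSystem.Estar_of_mem_reach {v : V} (hv : Φ.Estar 0 v = v) {l : ℕ}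
    {b : Fin (d + 1)} {w : V} (hw : w ∈ Φ.reach v l b) : Φ.Estar b w = w := by
  have hE := Φ.ordering_star_spec
  have hA := Φ.diag_star
  rw [← hE.mem_range_iff hA]
  suffices Φ.reach v l b ≤ LinearMap.range (Φ.Estar b) from this hw
  cases l with
  | zero =>
    rw [reach]
    split_ifs with hb
    · rw [Submodule.span_singleton_le_iff_mem, hE.mem_range_iff hA, hb, hv]
    · exact bot_le
  | succ l =>
    rw [reach]
    refine iSup_le fun a => iSup_le fun r => ?_
    rintro _ ⟨w, -, rfl⟩
    exact ⟨_, rfl⟩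

/-- In `reach v (l + 1) b` only those penultimate indices `a` are needed that lie on or below the
line from `(0, 0)` to `(l + 1, b)`: above the line some index is a peak, and peaks can be
lowered. -/
theorem TridiagonalSystem.reach_succ_le {q : 𝕜} (hq0 : q ≠ 0) (hq : ∀ n : ℕ, 0 < n → q ^ n ≠ 1)
    (hθ : ∀ i : Fin (d + 1), Φ.eigenvalue i = q ^ (2 * (i : ℤ) - (d : ℤ)))
    {v : V} (hv : Φ.Estar 0 v = v) (l : ℕ) :
    ∀ b : Fin (d + 1), Φ.reach v (l + 1) b ≤ ⨆ (a : Fin (d + 1))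
      (_ : (l + 1) * (a : ℕ) ≤ l * (b : ℕ)) (r : ℕ),
        (Φ.reach v l a).map (Φ.Estar b * Φ.A ^ r) := by
  induction l with
  | zero =>
    intro b
    rw [reach]
    refine iSup_le fun a => ?_
    by_cases ha : a = 0
    · subst ha
      exact le_iSup_of_le 0 (le_iSup_of_le (by simp) le_rfl)
    · simp [reach, ha]
  | succ l ih =>
    intro b
    set S := ⨆ (a : Fin (d + 1)) (_ : (l + 1 + 1) * (a : ℕ) ≤ (l + 1) * (b : ℕ)) (r : ℕ),
        (Φ.reach v (l + 1) a).map (Φ.Estar b * Φ.A ^ r) with hS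
    have hmem : ∀ a : Fin (d + 1), (l + 1 + 1) * (a : ℕ) ≤ (l + 1) * (b : ℕ) → ∀ (r : ℕ),
        ∀ w ∈ Φ.reach v (l + 1) a, (Φ.Estar b * Φ.A ^ r) w ∈ S := fun a ha r w hw =>
      Submodule.mem_iSup_of_mem a (Submodule.mem_iSup_of_mem ha
        (Submodule.mem_iSup_of_mem r ⟨w, hw, rfl⟩))
    suffices h : ∀ (N : ℕ) (a : Fin (d + 1)), (a : ℕ) = N → ∀ r : ℕ,
        (Φ.reach v (l + 1) a).map (Φ.Estar b * Φ.A ^ r) ≤ S by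
      rw [reach]
      exact iSup_le fun a => iSup_le fun r => h _ a rfl r
    intro N
    induction N using Nat.strong_induction_on with
    | _ N ihN =>
      intro a haN r
      by_cases hab : (l + 1 + 1) * (a : ℕ) ≤ (l + 1) * (b : ℕ)
      · rintro _ ⟨w, hw, rfl⟩
        exact hmem a hab r w hw
      · refine (Submodule.map_mono (ih a)).trans ?_
        simp only [Submodule.map_iSup]
        refine iSup_le fun a' => iSup_le fun ha' => iSup_le fun s => ?_
        rintro _ ⟨_, ⟨u, hu, rfl⟩, rfl⟩
        have hlow : ((b : ℕ) + a') / 2 < a := by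
          by_contra hcon
          have h1 : 2 * (a : ℕ) ≤ b + a' := by omega
          apply hab
          nlinarith
        have := Φ.word_apply_mem hq0 hq hθ (a := b) (b := a') (c := ((b : ℕ) + a') / 2)
          (by omega) (Φ.Estar_of_mem_reach hv hu) (S := S) (fun j hj r' s' => by
            have hj' : (Φ.Estar j * Φ.A ^ s') u ∈ Φ.reach v (l + 1) j :=
              Φ.mem_reach_succ hu j s'
            have := ihN j (by omega) j rfl r' ⟨_, hj', rfl⟩
            simpa [word, Module.End.mul_apply] using this) a r s
        simpa [word, Module.End.mul_apply] using this

theorem TridiagonalSystem.reach_zero_le {q : 𝕜} (hq0 : q ≠ 0) (hq : ∀ n : ℕ, 0 < n → q ^ n ≠ 1)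
    (hθ : ∀ i : Fin (d + 1), Φ.eigenvalue i = q ^ (2 * (i : ℤ) - (d : ℤ)))
    {v : V} (hv : Φ.Estar 0 v = v) (hμ : ∀ r : ℕ, ∃ μ : 𝕜, (Φ.Estar 0 * Φ.A ^ r) v = μ • v)
    (l : ℕ) : Φ.reach v l 0 ≤ 𝕜 ∙ v := by
  induction l with
  | zero => simp [reach]
  | succ l ih =>
    refine (reach_succ_le hq0 hq hθ hv l 0).trans ?_
    refine iSup_le fun a => iSup_le fun ha => iSup_le fun r => ?_
    obtain rfl : a = 0 := by
      apply Fin.ext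
      simpa using ha
    refine (Submodule.map_mono ih).trans ?_
    rw [Submodule.map_span_le]
    rintro _ rfl
    obtain ⟨μ, hμ⟩ := hμ r
    rw [hμ]
    exact Submodule.smul_mem _ _ (Submodule.mem_span_singleton_self _)

/-- A tridiagonal system with eigenvalues `θ_i = q ^ (2 i - d)` is sharp. -/
theorem TridiagonalSystem.isSharp [IsAlgClosed 𝕜] [FiniteDimensional 𝕜 V]
    {q : 𝕜} (hq0 : q ≠ 0) (hq : ∀ n : ℕ, 0 < n → q ^ n ≠ 1)
    (hθ : ∀ i : Fin (d + 1), Φ.eigenvalue i = q ^ (2 * (i : ℤ) - (d : ℤ))) : Φ.IsSharp := by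
  have hE := Φ.ordering_star_spec
  have hA := Φ.diag_star
  obtain ⟨v, hv0, hv, hμ⟩ := Φ.exists_common_eigenvector hq0 hq hθ
  set W : Submodule 𝕜 V := ⨆ (l : ℕ) (b : Fin (d + 1)), Φ.reach v l b with hW
  have hmem : ∀ {l b w}, w ∈ Φ.reach v l b → w ∈ W := fun {l b w} hw =>
    Submodule.mem_iSup_of_mem l (Submodule.mem_iSup_of_mem b hw)
  have hvW : v ∈ W := hmem (l := 0) (b := 0) (by simp [reach])
  have hWA : W.map Φ.A ≤ W := by
    rw [Submodule.map_le_iff_le_comap]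
    refine iSup_le fun l => iSup_le fun b w hw => ?_
    rw [Submodule.mem_comap, ← hE.sum_apply hA (Φ.A w)]
    refine Submodule.sum_mem _ fun i _ => hmem (l := l + 1) (b := i) ?_
    simpa [Module.End.mul_apply] using mem_reach_succ hw i 1
  have hWA' : W.map Φ.Astar ≤ W := by
    rw [Submodule.map_le_iff_le_comap]
    refine iSup_le fun l => iSup_le fun b w hw => ?_
    rw [Submodule.mem_comap, ← Estar_of_mem_reach hv hw, hE.apply_apply hA,
      Estar_of_mem_reach hv hw]
    exact Submodule.smul_mem _ _ (hmem hw)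
  have hWtop : W = ⊤ := by
    refine (Φ.irreducible W hWA hWA').resolve_left fun h => hv0 ?_
    rw [h] at hvW
    exact (Submodule.mem_bot 𝕜).mp hvW
  have hrange : LinearMap.range (Φ.Estar 0) = 𝕜 ∙ v := by
    apply le_antisymm
    · rw [LinearMap.range_eq_map, ← hWtop, Submodule.map_le_iff_le_comap]
      refine iSup_le fun l => iSup_le fun b w hw => ?_
      rw [Submodule.mem_comap, ← Estar_of_mem_reach hv hw, hE.idem hA]
      split_ifs with hb
      · subst hb
        rw [Estar_of_mem_reach hv hw]
        exact reach_zero_le hq0 hq hθ hv hμ l hw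
      · exact Submodule.zero_mem _
    · rw [Submodule.span_singleton_le_iff_mem]
      exact ⟨v, hv⟩
  rw [ParallelSystem.IsSharp, hrange]
  exact finrank_span_singleton hv0

end Sharp

/-! ### The split decomposition -/

section Split

theorem extendByZero_eq (U : Fin (d + 1) → Submodule 𝕜 V) {z : ℤ} {j : Fin (d + 1)}
    (h : (j : ℤ) = z) : extendByZero U z = U j := by
  apply le_antisymm
  · refine iSup_le fun i => iSup_le fun hi => ?_
    rw [show i = j from Fin.ext (by omega)]
  · exact le_iSup_of_le j (le_iSup_of_le h le_rfl)

theorem extendByZero_le {U : Fin (d + 1) → Submodule 𝕜 V} {z : ℤ} {W : Submodule 𝕜 V}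
    (h : ∀ j : Fin (d + 1), (j : ℤ) = z → U j ≤ W) : extendByZero U z ≤ W :=
  iSup_le fun j => iSup_le fun hj => h j hj

theorem eq_of_le_of_isInternal {U U' : Fin (d + 1) → Submodule 𝕜 V} (hle : ∀ i, U i ≤ U' i)
    (hU : DirectSum.IsInternal U) (hU' : DirectSum.IsInternal U') : U = U' := by
  rw [DirectSum.isInternal_submodule_iff_iSupIndep_and_iSup_eq_top] at hU hU'
  funext i
  refine le_antisymm (hle i) fun v hv => ?_
  have hv' : v ∈ U i ⊔ ⨆ (j) (_ : j ≠ i), U j := by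
    have htop : (⊤ : Submodule 𝕜 V) ≤ U i ⊔ ⨆ (j) (_ : j ≠ i), U j := by
      rw [← hU.2]
      refine iSup_le fun j => ?_
      by_cases hj : j = i
      · exact hj ▸ le_sup_left
      · exact le_sup_of_le_right (le_iSup_of_le j (le_iSup_of_le hj le_rfl))
    exact htop trivial
  obtain ⟨x, hx, y, hy, rfl⟩ := Submodule.mem_sup.mp hv'
  have hy1 : y ∈ U' i := (Submodule.add_mem_iff_right _ (hle i hx)).mp hv
  have hy2 : y ∈ ⨆ (j) (_ : j ≠ i), U' j :=
    (iSup_mono fun j => iSup_mono fun _ => hle j) hy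
  rw [Submodule.disjoint_def.mp (hU'.1 i) y hy1 hy2, add_zero]
  exact hx

/-- The vectors whose components for the indices above `i` vanish: `E_0 V + ⋯ + E_i V`. -/
def lowerFlag (E : Fin (d + 1) → Module.End 𝕜 V) (i : ℤ) : Submodule 𝕜 V :=
  ⨅ (k : Fin (d + 1)) (_ : i < k), LinearMap.ker (E k)

/-- The vectors whose components for the indices below `i` vanish: `E_i V + ⋯ + E_d V`. -/
def upperFlag (E : Fin (d + 1) → Module.End 𝕜 V) (i : ℤ) : Submodule 𝕜 V :=
  ⨅ (k : Fin (d + 1)) (_ : (k : ℤ) < i), LinearMap.ker (E k)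

theorem mem_lowerFlag {E : Fin (d + 1) → Module.End 𝕜 V} {i : ℤ} {v : V} :
    v ∈ lowerFlag E i ↔ ∀ k : Fin (d + 1), i < k → E k v = 0 := by
  simp [lowerFlag]

theorem mem_upperFlag {E : Fin (d + 1) → Module.End 𝕜 V} {i : ℤ} {v : V} :
    v ∈ upperFlag E i ↔ ∀ k : Fin (d + 1), (k : ℤ) < i → E k v = 0 := by
  simp [upperFlag]

variable {A X : Module.End 𝕜 V} {E : Fin (d + 1) → Module.End 𝕜 V} {θ : Fin (d + 1) → 𝕜}

theorem IsIdempotentOrdering.eq_zero_of_forall (h : IsIdempotentOrdering A E θ)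
    (hA : IsDiagonalizable A) {v : V} (hv : ∀ k, E k v = 0) : v = 0 := by
  rw [← h.sum_apply hA v]
  exact Finset.sum_eq_zero fun k _ => hv k

theorem IsIdempotentOrdering.apply_eq_zero_of_band (h : IsIdempotentOrdering A E θ)
    (hA : IsDiagonalizable A)
    (hX : ∀ i j : Fin (d + 1), 1 < |(i : ℤ) - (j : ℤ)| → E i * X * E j = 0) {v : V}
    (k : Fin (d + 1)) (hv : ∀ j : Fin (d + 1), |(k : ℤ) - (j : ℤ)| ≤ 1 → E j v = 0) :
    E k (X v) = 0 := by
  conv_lhs => rw [← h.sum_apply hA v]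
  rw [map_sum, map_sum]
  refine Finset.sum_eq_zero fun j _ => ?_
  by_cases hkj : 1 < |(k : ℤ) - (j : ℤ)|
  · exact congrArg (fun f : Module.End 𝕜 V => f v) (hX k j hkj)
  · rw [hv j (by omega), map_zero, map_zero]

theorem IsIdempotentOrdering.map_lowerFlag (h : IsIdempotentOrdering A E θ)
    (hA : IsDiagonalizable A)
    (hX : ∀ i j : Fin (d + 1), 1 < |(i : ℤ) - (j : ℤ)| → E i * X * E j = 0) {i : ℤ} {v : V}
    (hv : v ∈ lowerFlag E i) : X v ∈ lowerFlag E (i + 1) := by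
  rw [mem_lowerFlag] at hv ⊢
  refine fun k hk => h.apply_eq_zero_of_band hA hX k fun j hj => hv j ?_
  have := le_abs_self ((k : ℤ) - (j : ℤ))
  omega

theorem IsIdempotentOrdering.map_upperFlag (h : IsIdempotentOrdering A E θ)
    (hA : IsDiagonalizable A)
    (hX : ∀ i j : Fin (d + 1), 1 < |(i : ℤ) - (j : ℤ)| → E i * X * E j = 0) {i : ℤ} {v : V}
    (hv : v ∈ upperFlag E i) : X v ∈ upperFlag E (i - 1) := by
  rw [mem_upperFlag] at hv ⊢
  refine fun k hk => h.apply_eq_zero_of_band hA hX k fun j hj => hv j ?_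
  have := neg_abs_le ((k : ℤ) - (j : ℤ))
  omega

theorem IsIdempotentOrdering.apply_sub_smul (h : IsIdempotentOrdering A E θ)
    (hA : IsDiagonalizable A) (i k : Fin (d + 1)) (v : V) :
    E k (A v - θ i • v) = (θ k - θ i) • E k v := by
  rw [map_sub, map_smul, h.apply_comm hA, sub_smul]

theorem IsIdempotentOrdering.sub_mem_lowerFlag (h : IsIdempotentOrdering A E θ)
    (hA : IsDiagonalizable A) {i : Fin (d + 1)} {v : V} (hv : v ∈ lowerFlag E i) :
    A v - θ i • v ∈ lowerFlag E ((i : ℤ) - 1) := by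
  rw [mem_lowerFlag] at hv ⊢
  intro k hk
  rw [h.apply_sub_smul hA]
  by_cases hki : k = i
  · rw [hki, sub_self, zero_smul]
  · have : (k : ℕ) ≠ i := fun h => hki (Fin.ext h)
    rw [hv k (by omega), smul_zero]

theorem IsIdempotentOrdering.sub_mem_upperFlag (h : IsIdempotentOrdering A E θ)
    (hA : IsDiagonalizable A) {i : Fin (d + 1)} {v : V} (hv : v ∈ upperFlag E i) :
    A v - θ i • v ∈ upperFlag E ((i : ℤ) + 1) := by
  rw [mem_upperFlag] at hv ⊢
  intro k hk
  rw [h.apply_sub_smul hA]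
  by_cases hki : k = i
  · rw [hki, sub_self, zero_smul]
  · have : (k : ℕ) ≠ i := fun h => hki (Fin.ext h)
    rw [hv k (by omega), smul_zero]

variable (Φ : TridiagonalSystem 𝕜 V d)

/-- `(E*_0 V + ⋯ + E*_i V) ∩ (E_j V + ⋯ + E_d V)`, for arbitrary integers `i` and `j`. -/
def TridiagonalSystem.flagInter (i j : ℤ) : Submodule 𝕜 V :=
  lowerFlag Φ.Estar i ⊓ upperFlag Φ.E j

theorem TridiagonalSystem.flagInter_eq_bot_of_neg {i : ℤ} (hi : i < 0) (j : ℤ) :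
    Φ.flagInter i j = ⊥ := by
  refine (Submodule.eq_bot_iff _).mpr fun v hv => ?_
  exact Φ.ordering_star_spec.eq_zero_of_forall Φ.diag_star
    fun k => mem_lowerFlag.mp hv.1 k (by omega)

theorem TridiagonalSystem.flagInter_eq_bot_of_lt (i : ℤ) {j : ℤ} (hj : (d : ℤ) < j) :
    Φ.flagInter i j = ⊥ := by
  refine (Submodule.eq_bot_iff _).mpr fun v hv => ?_
  refine Φ.ordering_spec.eq_zero_of_forall Φ.diag fun k => mem_upperFlag.mp hv.2 k ?_
  have := k.isLt
  omega

theorem TridiagonalSystem.raise_flagInter {i : ℤ} {j : Fin (d + 1)} {v : V}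
    (hv : v ∈ Φ.flagInter i j) : Φ.A v - Φ.eigenvalue j • v ∈ Φ.flagInter (i + 1) (j + 1) := by
  refine ⟨Submodule.sub_mem _ (Φ.ordering_star_spec.map_lowerFlag Φ.diag_star Φ.tridiag_star hv.1)
    (Submodule.smul_mem _ _ (mem_lowerFlag.mpr fun k hk => mem_lowerFlag.mp hv.1 k (by omega))),
    Φ.ordering_spec.sub_mem_upperFlag Φ.diag hv.2⟩

theorem TridiagonalSystem.lower_flagInter {i : Fin (d + 1)} {j : ℤ} {v : V}
    (hv : v ∈ Φ.flagInter i j) :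
    Φ.Astar v - Φ.dualEigenvalue i • v ∈ Φ.flagInter (i - 1) (j - 1) := by
  refine ⟨Φ.ordering_star_spec.sub_mem_lowerFlag Φ.diag_star hv.1,
    Submodule.sub_mem _ (Φ.ordering_spec.map_upperFlag Φ.diag Φ.tridiag hv.2)
    (Submodule.smul_mem _ _ (mem_upperFlag.mpr fun k hk => mem_upperFlag.mp hv.2 k (by omega)))⟩

theorem TridiagonalSystem.exists_eigenvector_star (i : Fin (d + 1)) :
    ∃ v, v ≠ 0 ∧ Φ.Estar i v = v := by
  obtain ⟨v, h0, -, h⟩ := Φ.ordering_star_spec.exists_ne_zero i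
  exact ⟨v, h0, h⟩

/-- The sum of the spaces `flagInter i (i + r)` with a fixed `r ≥ 0` is invariant, hence trivial. -/
theorem TridiagonalSystem.iSup_flagInter {r : ℤ} (hr : 0 ≤ r) :
    ⨆ i : ℤ, Φ.flagInter i (i + r) = ⊥ ∨ ⨆ i : ℤ, Φ.flagInter i (i + r) = ⊤ := by
  apply Φ.irreducible
  · rw [Submodule.map_le_iff_le_comap]
    refine iSup_le fun i v hv => ?_
    rw [Submodule.mem_comap]
    by_cases h : 0 ≤ i ∧ i + r ≤ d
    · obtain ⟨k, hk⟩ : ∃ k : Fin (d + 1), (k : ℤ) = i + r :=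
        ⟨⟨(i + r).toNat, by omega⟩, by simp; omega⟩
      have h1 := Φ.raise_flagInter (j := k) (hk ▸ hv)
      rw [← sub_add_cancel (Φ.A v) (Φ.eigenvalue k • v)]
      refine Submodule.add_mem _ (Submodule.mem_iSup_of_mem (i + 1) ?_)
        (Submodule.smul_mem _ _ (Submodule.mem_iSup_of_mem i hv))
      rwa [hk, add_right_comm] at h1
    · have hbot : Φ.flagInter i (i + r) = ⊥ := by
        by_cases hi : 0 ≤ i
        · exact Φ.flagInter_eq_bot_of_lt _ (by omega)
        · exact Φ.flagInter_eq_bot_of_neg (by omega) _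
      rw [hbot, Submodule.mem_bot] at hv
      rw [hv, map_zero]
      exact Submodule.zero_mem _
  · rw [Submodule.map_le_iff_le_comap]
    refine iSup_le fun i v hv => ?_
    rw [Submodule.mem_comap]
    by_cases h : 0 ≤ i ∧ i + r ≤ d
    · obtain ⟨k, hk⟩ : ∃ k : Fin (d + 1), (k : ℤ) = i :=
        ⟨⟨i.toNat, by omega⟩, by simp; omega⟩
      have h1 := Φ.lower_flagInter (i := k) (j := i + r) (by rw [hk]; exact hv)
      rw [← sub_add_cancel (Φ.Astar v) (Φ.dualEigenvalue k • v)]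
      refine Submodule.add_mem _ (Submodule.mem_iSup_of_mem (i - 1) ?_)
        (Submodule.smul_mem _ _ (Submodule.mem_iSup_of_mem i hv))
      rwa [hk, add_sub_right_comm] at h1
    · have hbot : Φ.flagInter i (i + r) = ⊥ := by
        by_cases hi : 0 ≤ i
        · exact Φ.flagInter_eq_bot_of_lt _ (by omega)
        · exact Φ.flagInter_eq_bot_of_neg (by omega) _
      rw [hbot, Submodule.mem_bot] at hv
      rw [hv, map_zero]
      exact Submodule.zero_mem _

/-- The sum with `r = 1` lies in the kernel of `E_0`, so it is not `V`. -/
theorem TridiagonalSystem.flagInter_succ_eq_bot (i : ℤ) : Φ.flagInter i (i + 1) = ⊥ := by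
  rcases Φ.iSup_flagInter (r := 1) (by omega) with h | h
  · exact le_bot_iff.mp (h ▸ le_iSup (fun i : ℤ => Φ.flagInter i (i + 1)) i)
  · exfalso
    obtain ⟨v, hv0, -, hv⟩ := Φ.ordering_spec.exists_ne_zero 0
    have hle : ⨆ i : ℤ, Φ.flagInter i (i + 1) ≤ LinearMap.ker (Φ.E 0) := by
      refine iSup_le fun i w hw => ?_
      by_cases hi : 0 ≤ i
      · exact mem_upperFlag.mp hw.2 0 (by simp; omega)
      · rw [Φ.flagInter_eq_bot_of_neg (by omega), Submodule.mem_bot] at hw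
        rw [hw]
        exact Submodule.zero_mem _
    rw [h] at hle
    exact hv0 (hv ▸ hle (Submodule.mem_top (x := v)))

theorem TridiagonalSystem.flagInter_zero :
    Φ.flagInter 0 0 = LinearMap.range (Φ.Estar 0) := by
  have hE := Φ.ordering_star_spec
  have hA := Φ.diag_star
  ext v
  rw [hE.mem_range_iff hA]
  constructor
  · intro hv
    have h1 := hE.sum_apply hA v
    rwa [Finset.sum_eq_single 0 (fun k _ hk => mem_lowerFlag.mp hv.1 k (by
      have := Fin.pos_iff_ne_zero.mpr hk
      have : 0 < (k : ℕ) := this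
      omega)) (by simp)] at h1
  · intro hv
    refine ⟨mem_lowerFlag.mpr fun k hk => ?_, mem_upperFlag.mpr fun k hk => by omega⟩
    rw [← hv, hE.idem hA, if_neg]
    rintro rfl
    simp at hk

theorem TridiagonalSystem.iSup_flagInter_self : ⨆ i : ℤ, Φ.flagInter i i = ⊤ := by
  have h := Φ.iSup_flagInter (r := 0) le_rfl
  simp only [add_zero] at h
  refine h.resolve_left fun hbot => ?_
  obtain ⟨v, hv0, hv⟩ := Φ.exists_eigenvector_star 0
  have hmem : v ∈ Φ.flagInter 0 0 := Φ.flagInter_zero ▸ ⟨v, hv⟩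
  have := hbot ▸ Submodule.mem_iSup_of_mem (p := fun i : ℤ => Φ.flagInter i i) 0 hmem
  exact hv0 ((Submodule.mem_bot 𝕜).mp this)

/-- The component `U_i` of the split decomposition. -/
def TridiagonalSystem.splitSpace (i : Fin (d + 1)) : Submodule 𝕜 V :=
  Φ.flagInter i i

theorem TridiagonalSystem.flagInter_le_extendByZero (z : ℤ) :
    Φ.flagInter z z ≤ extendByZero Φ.splitSpace z := by
  by_cases h : 0 ≤ z ∧ z ≤ d
  · obtain ⟨k, rfl⟩ : ∃ k : Fin (d + 1), (k : ℤ) = z :=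
      ⟨⟨z.toNat, by omega⟩, by simp; omega⟩
    rw [extendByZero_eq _ rfl]
    exact le_rfl
  · have hbot : Φ.flagInter z z = ⊥ := by
      by_cases hi : 0 ≤ z
      · exact Φ.flagInter_eq_bot_of_lt _ (by omega)
      · exact Φ.flagInter_eq_bot_of_neg (by omega) _
    rw [hbot]
    exact bot_le

theorem TridiagonalSystem.iSupIndep_splitSpace : iSupIndep Φ.splitSpace := by
  classical
  rw [iSupIndep_iff_finsetSum_eq_zero_imp_eq_zero]
  intro s v hv hsum
  by_contra hcon
  push Not at hcon
  obtain ⟨i₀, hi₀, hvi₀⟩ := hcon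
  obtain ⟨i, hi, hmax⟩ := (s.filter fun i => v i ≠ 0).exists_max_image id
    ⟨i₀, Finset.mem_filter.mpr ⟨hi₀, hvi₀⟩⟩
  obtain ⟨his, hvi⟩ := Finset.mem_filter.mp hi
  rw [← Finset.add_sum_erase _ _ his] at hsum
  have hlow : ∑ j ∈ s.erase i, v j ∈ lowerFlag Φ.Estar ((i : ℤ) - 1) := by
    refine Submodule.sum_mem _ fun j hj => ?_
    by_cases hj0 : v j = 0
    · rw [hj0]
      exact Submodule.zero_mem _
    · have hji : j ≤ i :=
        hmax j (Finset.mem_filter.mpr ⟨Finset.mem_of_mem_erase hj, hj0⟩)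
      have hlt : (j : ℕ) < i := lt_of_le_of_ne hji (Fin.val_ne_of_ne (Finset.ne_of_mem_erase hj))
      refine mem_lowerFlag.mpr fun k hk => ?_
      exact mem_lowerFlag.mp (hv j (Finset.mem_of_mem_erase hj)).1 k (by omega)
  have hmem : v i ∈ Φ.flagInter ((i : ℤ) - 1) ((i : ℤ) - 1 + 1) := by
    refine ⟨?_, ?_⟩
    · rw [eq_neg_of_add_eq_zero_left hsum]
      exact Submodule.neg_mem _ hlow
    · rw [sub_add_cancel]
      exact (hv i his).2
  rw [Φ.flagInter_succ_eq_bot, Submodule.mem_bot] at hmem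
  exact hvi hmem

theorem TridiagonalSystem.isInternal_splitSpace : DirectSum.IsInternal Φ.splitSpace := by
  rw [DirectSum.isInternal_submodule_iff_iSupIndep_and_iSup_eq_top]
  refine ⟨Φ.iSupIndep_splitSpace, top_le_iff.mp ?_⟩
  rw [← Φ.iSup_flagInter_self]
  exact iSup_le fun z => (Φ.flagInter_le_extendByZero z).trans
    (extendByZero_le fun j _ => le_iSup _ j)

theorem TridiagonalSystem.splitSpace_ne_bot (i : Fin (d + 1)) : Φ.splitSpace i ≠ ⊥ := by
  intro hbot
  have h0 : Φ.splitSpace 0 ≠ ⊥ := by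
    obtain ⟨v, hv0, hv⟩ := Φ.exists_eigenvector_star 0
    exact (Submodule.ne_bot_iff _).mpr ⟨v, by
      change v ∈ Φ.flagInter ((0 : Fin (d + 1)) : ℕ) ((0 : Fin (d + 1)) : ℕ)
      simpa using Φ.flagInter_zero ▸ (⟨v, hv⟩ : v ∈ LinearMap.range (Φ.Estar 0)), hv0⟩
  have hi0 : i ≠ 0 := by
    rintro rfl
    exact h0 hbot
  -- Since `U_i = 0`, the sum of the earlier spaces is invariant.
  set Z : Submodule 𝕜 V := ⨆ (j : Fin (d + 1)) (_ : j < i), Φ.splitSpace j with hZ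
  have hmemZ : ∀ z : ℤ, z ≤ i → Φ.flagInter z z ≤ Z := by
    intro z hz
    refine (Φ.flagInter_le_extendByZero z).trans (extendByZero_le fun j hj => ?_)
    by_cases hji : j = i
    · rw [hji, hbot]
      exact bot_le
    · refine le_iSup_of_le j (le_iSup_of_le (lt_of_le_of_ne ?_ hji) le_rfl)
      exact Fin.le_def.mpr (by omega)
  have hZA : Z.map Φ.A ≤ Z := by
    rw [Submodule.map_le_iff_le_comap]
    refine iSup_le fun j => iSup_le fun hj v hv => ?_
    have hj' : (j : ℕ) < i := hj
    rw [Submodule.mem_comap, ← sub_add_cancel (Φ.A v) (Φ.eigenvalue j • v)]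
    exact Submodule.add_mem _ (hmemZ (j + 1) (by omega) (Φ.raise_flagInter hv))
      (Submodule.smul_mem _ _ (hmemZ j (by omega) hv))
  have hZA' : Z.map Φ.Astar ≤ Z := by
    rw [Submodule.map_le_iff_le_comap]
    refine iSup_le fun j => iSup_le fun hj v hv => ?_
    have hj' : (j : ℕ) < i := hj
    rw [Submodule.mem_comap, ← sub_add_cancel (Φ.Astar v) (Φ.dualEigenvalue j • v)]
    exact Submodule.add_mem _ (hmemZ (j - 1) (by omega) (Φ.lower_flagInter hv))
      (Submodule.smul_mem _ _ (hmemZ j (by omega) hv))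
  have h0Z : Φ.splitSpace 0 ≤ Z :=
    le_iSup_of_le 0 (le_iSup_of_le (Fin.pos_iff_ne_zero.mpr hi0) le_rfl)
  rcases Φ.irreducible Z hZA hZA' with h | h
  · exact h0 (le_bot_iff.mp (h ▸ h0Z))
  · obtain ⟨v, hv0, hv⟩ := Φ.exists_eigenvector_star i
    have hle : Z ≤ LinearMap.ker (Φ.Estar i) := by
      refine iSup_le fun j => iSup_le fun hj w hw => ?_
      have hj' : (j : ℕ) < i := hj
      exact mem_lowerFlag.mp hw.1 i (by omega)
    rw [h] at hle
    exact hv0 (hv ▸ hle (Submodule.mem_top (x := v)))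

theorem TridiagonalSystem.isSplitDecomposition_splitSpace :
    IsSplitDecomposition Φ Φ.splitSpace where
  ne_bot := Φ.splitSpace_ne_bot
  isInternal := Φ.isInternal_splitSpace
  raise i := by
    rintro _ ⟨v, hv, rfl⟩
    exact Φ.flagInter_le_extendByZero _ (by simpa using Φ.raise_flagInter hv)
  lower i := by
    rintro _ ⟨v, hv, rfl⟩
    exact Φ.flagInter_le_extendByZero _ (by simpa using Φ.lower_flagInter hv)

theorem IsSplitDecomposition.raise_apply {Φ : TridiagonalSystem 𝕜 V d}
    {U : Fin (d + 1) → Submodule 𝕜 V} (hU : IsSplitDecomposition Φ U) {i : Fin (d + 1)} {v : V}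
    (hv : v ∈ U i) : Φ.A v - Φ.eigenvalue i • v ∈ extendByZero U ((i : ℤ) + 1) := by
  simpa using hU.raise i ⟨v, hv, rfl⟩

theorem IsSplitDecomposition.lower_apply {Φ : TridiagonalSystem 𝕜 V d}
    {U : Fin (d + 1) → Submodule 𝕜 V} (hU : IsSplitDecomposition Φ U) {i : Fin (d + 1)} {v : V}
    (hv : v ∈ U i) : Φ.Astar v - Φ.dualEigenvalue i • v ∈ extendByZero U ((i : ℤ) - 1) := by
  simpa using hU.lower i ⟨v, hv, rfl⟩

theorem IsSplitDecomposition.le_upperFlag {Φ : TridiagonalSystem 𝕜 V d}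
    {U : Fin (d + 1) → Submodule 𝕜 V} (hU : IsSplitDecomposition Φ U) (i : Fin (d + 1)) :
    U i ≤ upperFlag Φ.E i := by
  induction hN : d - (i : ℕ) using Nat.strong_induction_on generalizing i with
  | _ N ih =>
    intro v hv
    have hx : Φ.A v - Φ.eigenvalue i • v ∈ upperFlag Φ.E ((i : ℤ) + 1) := by
      refine extendByZero_le (fun j hj => ?_) (hU.raise_apply hv)
      have := j.isLt
      rw [← hj]
      exact ih (d - j) (by omega) j rfl
    refine mem_upperFlag.mpr fun k hk => ?_
    have := mem_upperFlag.mp hx k (by omega)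
    rw [Φ.ordering_spec.apply_sub_smul Φ.diag] at this
    refine (smul_eq_zero.mp this).resolve_left (sub_ne_zero.mpr ?_)
    exact Φ.ordering_spec.injective.ne (by rintro rfl; exact lt_irrefl _ hk)

theorem IsSplitDecomposition.le_lowerFlag {Φ : TridiagonalSystem 𝕜 V d}
    {U : Fin (d + 1) → Submodule 𝕜 V} (hU : IsSplitDecomposition Φ U) (i : Fin (d + 1)) :
    U i ≤ lowerFlag Φ.Estar i := by
  induction hN : (i : ℕ) using Nat.strong_induction_on generalizing i with
  | _ N ih =>
    intro v hv
    have hx : Φ.Astar v - Φ.dualEigenvalue i • v ∈ lowerFlag Φ.Estar ((i : ℤ) - 1) := by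
      refine extendByZero_le (fun j hj => ?_) (hU.lower_apply hv)
      rw [← hj]
      exact ih j (by omega) j rfl
    refine mem_lowerFlag.mpr fun k hk => ?_
    have := mem_lowerFlag.mp hx k (by omega)
    rw [Φ.ordering_star_spec.apply_sub_smul Φ.diag_star] at this
    refine (smul_eq_zero.mp this).resolve_left (sub_ne_zero.mpr ?_)
    exact Φ.ordering_star_spec.injective.ne (by rintro rfl; omega)

theorem IsSplitDecomposition.eq_splitSpace {Φ : TridiagonalSystem 𝕜 V d}
    {U : Fin (d + 1) → Submodule 𝕜 V} (hU : IsSplitDecomposition Φ U) : U = Φ.splitSpace :=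
  eq_of_le_of_isInternal (fun i => le_inf (hU.le_lowerFlag i) (hU.le_upperFlag i)) hU.isInternal
    Φ.isInternal_splitSpace

theorem IsSplitDecomposition.zero_eq_range {Φ : TridiagonalSystem 𝕜 V d}
    {U : Fin (d + 1) → Submodule 𝕜 V} (hU : IsSplitDecomposition Φ U) :
    U 0 = LinearMap.range (Φ.Estar 0) := by
  rw [hU.eq_splitSpace, ← Φ.flagInter_zero]
  simp [TridiagonalSystem.splitSpace]

end Split

/-! ### Lower triangular maps, the weight map and the perturbation -/

section Triangular

variable {M : Module.End 𝕜 V} {η : Fin (d + 1) → 𝕜} {U : Fin (d + 1) → Submodule 𝕜 V}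

theorem aeval_prod_Iic_eq_zero
    (hlow : ∀ i, ∀ u ∈ U i, M u - η i • u ∈ extendByZero U ((i : ℤ) - 1)) (n : ℕ) :
    ∀ (h : n < d + 1), ∀ u ∈ U ⟨n, h⟩, Polynomial.aeval M
      (∏ j ∈ Finset.Iic (⟨n, h⟩ : Fin (d + 1)), (Polynomial.X - Polynomial.C (η j))) u = 0 := by
  induction n with
  | zero =>
    intro h u hu
    have hbot : extendByZero U (((⟨0, h⟩ : Fin (d + 1)) : ℤ) - 1) = ⊥ :=
      le_bot_iff.mp (extendByZero_le fun j hj => by simp at hj)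
    have h0 := hlow _ u hu
    rw [hbot, Submodule.mem_bot] at h0
    rw [show Finset.Iic (⟨0, h⟩ : Fin (d + 1)) = {⟨0, h⟩} by
      ext j
      simp only [Finset.mem_Iic, Finset.mem_singleton, Fin.le_def, Fin.ext_iff]
      omega]
    simpa [Module.algebraMap_end_apply] using h0
  | succ n ih =>
    intro h u hu
    have hn : n < d + 1 := by omega
    have hx := hlow _ u hu
    rw [extendByZero_eq U (j := ⟨n, hn⟩) (by simp)] at hx
    have hins : Finset.Iic (⟨n + 1, h⟩ : Fin (d + 1)) =
        insert ⟨n + 1, h⟩ (Finset.Iic (⟨n, hn⟩ : Fin (d + 1))) := by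
      ext j
      simp only [Finset.mem_Iic, Finset.mem_insert, Fin.le_def, Fin.ext_iff]
      omega
    rw [hins, Finset.prod_insert (by simp [Fin.le_def]), mul_comm, map_mul, Module.End.mul_apply]
    have hev : Polynomial.aeval M (Polynomial.X - Polynomial.C (η ⟨n + 1, h⟩)) u =
        M u - η ⟨n + 1, h⟩ • u := by
      simp [Module.algebraMap_end_apply]
    rw [hev]
    exact ih hn _ hx

theorem aeval_nodal_eq_zero (hint : DirectSum.IsInternal U)
    (hlow : ∀ i, ∀ u ∈ U i, M u - η i • u ∈ extendByZero U ((i : ℤ) - 1)) :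
    Polynomial.aeval M (∏ j, (Polynomial.X - Polynomial.C (η j))) = 0 := by
  rw [← LinearMap.ker_eq_top, ← top_le_iff, ← hint.submodule_iSup_eq_top]
  refine iSup_le fun i u hu => ?_
  rw [LinearMap.mem_ker, ← Finset.prod_sdiff (Finset.subset_univ (Finset.Iic i)), map_mul,
    Module.End.mul_apply, aeval_prod_Iic_eq_zero hlow i i.isLt u hu, map_zero]

/-- A map that is triangular with respect to a decomposition, with distinct diagonal scalars, is
diagonalizable, and these scalars are its eigenvalues. -/
theorem isIdempotentOrdering_of_triangular (hη : Function.Injective η) (hne : ∀ i, U i ≠ ⊥)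
    (hint : DirectSum.IsInternal U)
    (hlow : ∀ i, ∀ u ∈ U i, M u - η i • u ∈ extendByZero U ((i : ℤ) - 1)) :
    IsDiagonalizable M ∧ IsIdempotentOrdering M (primitiveIdempotent M η) η := by
  have hnodal := aeval_nodal_eq_zero hint hlow
  have hEig : ∀ i v, M (primitiveIdempotent M η i v) = η i • primitiveIdempotent M η i v := by
    intro i v
    have hpoly : (Polynomial.X - Polynomial.C (η i)) * Lagrange.basis Finset.univ η i =
        (∏ j ∈ Finset.univ.erase i, Polynomial.C (η i - η j)⁻¹) *
          ∏ j, (Polynomial.X - Polynomial.C (η j)) := by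
      rw [Lagrange.basis, ← Finset.mul_prod_erase _ _ (Finset.mem_univ i)]
      simp only [Lagrange.basisDivisor, Finset.prod_mul_distrib]
      ring
    have h0 := congrArg (fun p => Polynomial.aeval M p v) hpoly
    simp only [map_mul, hnodal, mul_zero, LinearMap.zero_apply, Module.End.mul_apply] at h0
    rw [← sub_eq_zero]
    simpa [primitiveIdempotent, Module.algebraMap_end_apply] using h0
  refine ⟨?_, hη, fun μ => ⟨fun hμ => ?_, ?_⟩, fun i => rfl⟩
  · rw [IsDiagonalizable, ← top_le_iff]
    intro v _
    have hsum := congrArg (fun p => Polynomial.aeval M p v)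
      (Lagrange.sum_basis (s := Finset.univ) (v := η) hη.injOn ⟨0, Finset.mem_univ 0⟩)
    simp only [map_sum, map_one, LinearMap.sum_apply, Module.End.one_apply] at hsum
    rw [← hsum]
    exact Submodule.sum_mem _ fun i _ => Submodule.mem_iSup_of_mem (η i)
      (Module.End.mem_eigenspace_iff.mpr (hEig i v))
  · obtain ⟨v, hv⟩ := hμ.exists_hasEigenvector
    have h0 := aeval_apply_of_eigen (Module.End.mem_eigenspace_iff.mp hv.1)
      (∏ j, (Polynomial.X - Polynomial.C (η j)))
    rw [hnodal, LinearMap.zero_apply, eq_comm, smul_eq_zero] at h0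
    have h1 := h0.resolve_right hv.2
    rw [Polynomial.eval_prod, Finset.prod_eq_zero_iff] at h1
    obtain ⟨i, -, hi⟩ := h1
    refine ⟨i, ?_⟩
    simpa [sub_eq_zero, eq_comm] using hi
  · rintro ⟨i, rfl⟩
    obtain ⟨u, hu, hu0⟩ := (Submodule.ne_bot_iff _).mp (hne i)
    -- Modulo the earlier spaces, a polynomial in `M` acts on `U i` through its value at `η i`.
    set L : Submodule 𝕜 V := ⨆ (j : Fin (d + 1)) (_ : j < i), U j with hL
    have hext : ∀ z : ℤ, z < i → extendByZero U z ≤ L := fun z hz =>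
      extendByZero_le fun j hj => le_iSup_of_le j (le_iSup_of_le (Fin.lt_def.mpr (by omega)) le_rfl)
    have hML : ∀ w ∈ L, M w ∈ L := by
      suffices L ≤ L.comap M from this
      refine iSup_le fun j => iSup_le fun hj w hw => ?_
      have hj' : (j : ℕ) < i := hj
      rw [Submodule.mem_comap, ← sub_add_cancel (M w) (η j • w)]
      exact Submodule.add_mem _ (hext _ (by omega) (hlow j w hw))
        (Submodule.smul_mem _ _ (Submodule.mem_iSup_of_mem j (Submodule.mem_iSup_of_mem hj hw)))
    have hpL : ∀ (p : 𝕜[X]), ∀ w ∈ L, Polynomial.aeval M p w ∈ L := by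
      intro p
      induction p using Polynomial.induction_on' with
      | add p r hp hr =>
        intro w hw
        rw [map_add, LinearMap.add_apply]
        exact L.add_mem (hp w hw) (hr w hw)
      | monomial n a =>
        intro w hw
        rw [Polynomial.aeval_monomial, Module.End.mul_apply, Module.algebraMap_end_apply]
        refine L.smul_mem _ ?_
        induction n with
        | zero => simpa using hw
        | succ n ih =>
          rw [pow_succ', Module.End.mul_apply]
          exact hML _ ih
    have hdisj : Disjoint (U i) L := by
      have := (DirectSum.isInternal_submodule_iff_iSupIndep_and_iSup_eq_top U).mp hint
      exact (this.1 i).mono_right (iSup_mono fun j => iSup_mono' fun hj => ⟨ne_of_lt hj, le_rfl⟩)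
    refine Module.End.hasEigenvalue_of_hasEigenvector (x := primitiveIdempotent M η i u)
      ⟨Module.End.mem_eigenspace_iff.mpr (hEig i u), fun hzero => hu0 ?_⟩
    obtain ⟨g, hg⟩ : (Polynomial.X - Polynomial.C (η i)) ∣
        Lagrange.basis Finset.univ η i - 1 := by
      rw [Polynomial.dvd_iff_isRoot, Polynomial.IsRoot, Polynomial.eval_sub,
        Lagrange.eval_basis_self hη.injOn (Finset.mem_univ i), Polynomial.eval_one, sub_self]
    have h1 := congrArg (fun p => Polynomial.aeval M p u) hg
    simp only [map_sub, map_one, mul_comm (Polynomial.X - Polynomial.C (η i)), map_mul,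
      LinearMap.sub_apply, Module.End.one_apply, Module.End.mul_apply, Polynomial.aeval_X,
      Polynomial.aeval_C, Module.algebraMap_end_apply] at h1
    rw [show Polynomial.aeval M (Lagrange.basis Finset.univ η i) u = 0 from hzero, zero_sub] at h1
    refine Submodule.disjoint_def.mp hdisj u hu ?_
    rw [← Submodule.neg_mem_iff, h1, ← map_sub]
    exact hpL g _ (hext _ (by omega) (hlow i u hu))

end Triangular

section Weight

/-- For distinct scalars, a unique map has the spaces of a decomposition as its eigenspaces. -/
theorem existsUnique_eigenspace_eq {U : Fin (d + 1) → Submodule 𝕜 V} {η : Fin (d + 1) → 𝕜}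
    (hη : Function.Injective η) (hint : DirectSum.IsInternal U) :
    ∃! K : Module.End 𝕜 V, ∀ i, K.eigenspace (η i) = U i := by
  classical
  let e := LinearEquiv.ofBijective (DirectSum.coeLinearMap U) hint
  let K : Module.End 𝕜 V :=
    (DirectSum.toModule 𝕜 _ V fun i => η i • (U i).subtype) ∘ₗ e.symm.toLinearMap
  have hK : ∀ i, ∀ u ∈ U i, K u = η i • u := by
    intro i u hu
    have he : e.symm u = DirectSum.lof 𝕜 _ (fun i => U i) i ⟨u, hu⟩ := by
      rw [LinearEquiv.symm_apply_eq]
      exact (DirectSum.coeLinearMap_lof U i ⟨u, hu⟩).symm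
    simp [K, he]
  have hle : ∀ i, U i ≤ K.eigenspace (η i) := fun i u hu =>
    Module.End.mem_eigenspace_iff.mpr (hK i u hu)
  have hint' : DirectSum.IsInternal fun i => K.eigenspace (η i) := by
    rw [DirectSum.isInternal_submodule_iff_iSupIndep_and_iSup_eq_top]
    refine ⟨K.eigenspaces_iSupIndep.comp hη, top_le_iff.mp ?_⟩
    rw [← hint.submodule_iSup_eq_top]
    exact iSup_mono hle
  have heq := eq_of_le_of_isInternal hle hint hint'
  refine ⟨K, fun i => (congrFun heq i).symm, fun K' hK' => ?_⟩
  have htop : (⊤ : Submodule 𝕜 V) ≤ LinearMap.eqLocus K' K := by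
    rw [← hint.submodule_iSup_eq_top]
    refine iSup_le fun i u hu => ?_
    change K' u = K u
    rw [hK i u hu]
    exact Module.End.mem_eigenspace_iff.mp ((hK' i).symm ▸ hu)
  exact LinearMap.ext fun v => htop trivial

end Weight

section Perturbation

variable {Φ : TridiagonalSystem 𝕜 V d} {U : Fin (d + 1) → Submodule 𝕜 V} {K : Module.End 𝕜 V}

theorem perturbation_apply_sub (hK : ∀ i, ∀ u ∈ U i, K u = Φ.dualEigenvalue i • u) (t : 𝕜)
    (i : Fin (d + 1)) {u : V} (hu : u ∈ U i) :
    (t • Φ.Astar + (1 - t) • K) u - Φ.dualEigenvalue i • u =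
      t • (Φ.Astar u - Φ.dualEigenvalue i • u) := by
  simp only [LinearMap.add_apply, LinearMap.smul_apply, hK i u hu]
  module

theorem IsSplitDecomposition.perturbation_ordering (hU : IsSplitDecomposition Φ U)
    (hK : ∀ i, ∀ u ∈ U i, K u = Φ.dualEigenvalue i • u) (t : 𝕜) :
    IsDiagonalizable (t • Φ.Astar + (1 - t) • K) ∧
      IsIdempotentOrdering (t • Φ.Astar + (1 - t) • K)
        (primitiveIdempotent (t • Φ.Astar + (1 - t) • K) Φ.dualEigenvalue) Φ.dualEigenvalue := by
  refine isIdempotentOrdering_of_triangular Φ.ordering_star_spec.injective hU.ne_bot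
    hU.isInternal fun i u hu => ?_
  rw [perturbation_apply_sub hK t i hu]
  exact Submodule.smul_mem _ _ (hU.lower_apply hu)

/-- On `U_i` the idempotent `E'_0` is `t ^ i` times `E*_0`: each of the `i` lowering steps from
`U_i` to `U_0` contributes a factor `t`. -/
theorem IsSplitDecomposition.perturbation_idempotent_apply (hU : IsSplitDecomposition Φ U)
    (hK : ∀ i, ∀ u ∈ U i, K u = Φ.dualEigenvalue i • u) (t : 𝕜) (n : ℕ) :
    ∀ (h : n < d + 1), ∀ u ∈ U ⟨n, h⟩,
      primitiveIdempotent (t • Φ.Astar + (1 - t) • K) Φ.dualEigenvalue 0 u =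
        t ^ n • Φ.Estar 0 u := by
  obtain ⟨hdiag, hord⟩ := hU.perturbation_ordering hK t
  have hE := Φ.ordering_star_spec
  induction n with
  | zero =>
    intro h u hu
    have hu0 : u ∈ U 0 := hu
    have hu' : Φ.Estar 0 u = u := by
      rw [hU.zero_eq_range] at hu0
      exact (hE.mem_range_iff Φ.diag_star).mp hu0
    have hA : Φ.Astar u = Φ.dualEigenvalue 0 • u := by
      have := hE.apply_apply Φ.diag_star 0 u
      rwa [hu'] at this
    have hM := perturbation_apply_sub hK t 0 hu0
    rw [hA, sub_self, smul_zero, sub_eq_zero] at hM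
    rw [hord.apply_of_eigen hM, if_pos rfl, hu', pow_zero, one_smul]
  | succ n ih =>
    intro h u hu
    have hn : n < d + 1 := by omega
    have hx := hU.lower_apply hu
    rw [extendByZero_eq U (j := ⟨n, hn⟩) (by simp)] at hx
    have hne : Φ.dualEigenvalue 0 - Φ.dualEigenvalue ⟨n + 1, h⟩ ≠ 0 :=
      sub_ne_zero.mpr (hE.injective.ne (by simp [Fin.ext_iff]))
    have h1 := hord.apply_sub_smul hdiag ⟨n + 1, h⟩ 0 u
    rw [perturbation_apply_sub hK t _ hu, map_smul, ih hn _ hx,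
      hE.apply_sub_smul Φ.diag_star] at h1
    apply smul_right_injective V hne
    change _ • _ = _ • _
    rw [← h1, smul_smul, smul_smul, smul_smul]
    congr 1
    ring

theorem IsSplitDecomposition.perturbation_range (hU : IsSplitDecomposition Φ U)
    (hK : ∀ i, ∀ u ∈ U i, K u = Φ.dualEigenvalue i • u) (t : 𝕜) :
    LinearMap.range (primitiveIdempotent (t • Φ.Astar + (1 - t) • K) Φ.dualEigenvalue 0) =
      LinearMap.range (Φ.Estar 0) := by
  apply le_antisymm
  · rw [LinearMap.range_eq_map, ← hU.isInternal.submodule_iSup_eq_top,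
      Submodule.map_le_iff_le_comap]
    refine iSup_le fun i u hu => ?_
    rw [Submodule.mem_comap, hU.perturbation_idempotent_apply hK t i i.isLt u hu]
    exact Submodule.smul_mem _ _ ⟨u, rfl⟩
  · rintro v hv
    have hv' := (Φ.ordering_star_spec.mem_range_iff Φ.diag_star).mp hv
    rw [← hU.zero_eq_range] at hv
    refine ⟨v, ?_⟩
    rw [hU.perturbation_idempotent_apply hK t 0 (by omega) v hv, hv', pow_zero, one_smul]

theorem IsSplitDecomposition.aeval_tau_mem (hU : IsSplitDecomposition Φ U) {v : V}
    (hv : v ∈ U 0) (n : ℕ) :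
    ∀ h : n < d + 1, Polynomial.aeval Φ.A (Φ.tau ⟨n, h⟩) v ∈ U ⟨n, h⟩ := by
  induction n with
  | zero =>
    intro h
    have : Finset.Iio (⟨0, h⟩ : Fin (d + 1)) = ∅ := by
      ext j
      simp
    rw [ParallelSystem.tau, this]
    simpa using hv
  | succ n ih =>
    intro h
    have hn : n < d + 1 := by omega
    have hins : Finset.Iio (⟨n + 1, h⟩ : Fin (d + 1)) =
        insert ⟨n, hn⟩ (Finset.Iio (⟨n, hn⟩ : Fin (d + 1))) := by
      ext j
      simp only [Finset.mem_Iio, Finset.mem_insert, Fin.lt_def, Fin.ext_iff]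
      omega
    have hx := hU.raise_apply (ih hn)
    rw [extendByZero_eq U (j := ⟨n + 1, h⟩) (by simp)] at hx
    rw [ParallelSystem.tau, hins, Finset.prod_insert (by simp), map_mul, Module.End.mul_apply]
    simpa [ParallelSystem.tau, Module.algebraMap_end_apply] using hx

theorem ParallelSystem.chi_spec (Φ : ParallelSystem 𝕜 V d) (h : Φ.IsSharp) (i : Fin (d + 1))
    {v : V} (hv : v ∈ LinearMap.range (Φ.Estar 0)) :
    Φ.Estar 0 (Polynomial.aeval Φ.A (Φ.tau i) v) = Φ.chi h i • v :=
  (Φ.exists_chi h i).choose_spec v hv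

/-- The linear perturbation is a sharp parallel system with split sequence `t ^ i * ζ_i`. -/
theorem IsSplitDecomposition.exists_perturbation (hU : IsSplitDecomposition Φ U)
    (hK : ∀ i, ∀ u ∈ U i, K u = Φ.dualEigenvalue i • u) (hΦ : Φ.IsSharp) (t : 𝕜) :
    ∃ Φ' : ParallelSystem 𝕜 V d, IsLinearPerturbation Φ K t Φ' ∧ ∃ hΦ' : Φ'.IsSharp,
      Φ'.parameterArray hΦ' = (Φ.eigenvalue, Φ.dualEigenvalue,
        fun i : Fin (d + 1) => t ^ (i : ℕ) * Φ.splitSequence hΦ i) := by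
  obtain ⟨hdiag, hord⟩ := hU.perturbation_ordering hK t
  have hrange := hU.perturbation_range hK t
  let Φ' : ParallelSystem 𝕜 V d :=
    { A := Φ.A
      E := Φ.E
      Astar := t • Φ.Astar + (1 - t) • K
      Estar := primitiveIdempotent (t • Φ.Astar + (1 - t) • K) Φ.dualEigenvalue
      diag := Φ.diag
      diag_star := hdiag
      ordering := Φ.ordering
      ordering_star := ⟨_, hord⟩ }
  have hΦ' : Φ'.IsSharp := by
    change Module.finrank 𝕜 (LinearMap.range _) = 1
    rw [hrange]
    exact hΦ
  have hθ' : Φ'.eigenvalue = Φ.eigenvalue := rfl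
  have hθs' : Φ'.dualEigenvalue = Φ.dualEigenvalue :=
    Φ'.ordering_star.choose_spec.eigenvalue_unique hord hdiag
  refine ⟨Φ', ⟨rfl, rfl, rfl, rfl⟩, hΦ', ?_⟩
  have hchi : ∀ i, Φ'.chi hΦ' i = t ^ (i : ℕ) * Φ.chi hΦ i := by
    intro i
    obtain ⟨v, hv0, hv⟩ := Φ.exists_eigenvector_star 0
    have hvr : v ∈ LinearMap.range (Φ.Estar 0) := ⟨v, hv⟩
    have h1 := Φ'.chi_spec hΦ' i (v := v) (hrange.symm ▸ hvr)
    have h2 := hU.perturbation_idempotent_apply hK t i i.isLt _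
      (hU.aeval_tau_mem (hU.zero_eq_range.symm ▸ hvr) i i.isLt)
    have h3 : Φ'.chi hΦ' i • v = (t ^ (i : ℕ) * Φ.chi hΦ i) • v := by
      rw [← h1, mul_smul, ← Φ.chi_spec hΦ i hvr]
      exact h2
    exact smul_left_injective 𝕜 hv0 h3
  rw [ParallelSystem.parameterArray, hθ', hθs']
  congr 2
  funext i
  rw [ParallelSystem.splitSequence, ParallelSystem.splitSequence, hchi, hθs']
  ring

end Perturbation

end TridiagonalPerturbation

end

theorem corollary6p10 {𝕜 : Type*} [Field 𝕜] [IsAlgClosed 𝕜]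
    {V : Type*} [AddCommGroup V] [Module 𝕜 V] [FiniteDimensional 𝕜 V] [Nontrivial V]
    (q : 𝕜) (hq0 : q ≠ 0) (hq : ∀ n : ℕ, 0 < n → q ^ n ≠ 1)
    (d : ℕ) (Φ : TridiagonalPerturbation.TridiagonalSystem 𝕜 V d)
    (hθ : ∀ i : Fin (d + 1), Φ.eigenvalue i = q ^ (2 * (i : ℤ) - (d : ℤ)))
    (hθstar : ∀ i : Fin (d + 1), Φ.dualEigenvalue i = q ^ ((d : ℤ) - 2 * (i : ℤ))) :
    (∃! U : Fin (d + 1) → Submodule 𝕜 V, TridiagonalPerturbation.IsSplitDecomposition Φ U) ∧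
    ∀ U : Fin (d + 1) → Submodule 𝕜 V, TridiagonalPerturbation.IsSplitDecomposition Φ U →
      (∃! K : Module.End 𝕜 V, TridiagonalPerturbation.IsWeightMap q U K) ∧
      ∀ K : Module.End 𝕜 V, TridiagonalPerturbation.IsWeightMap q U K →
        ∃ hΦ : Φ.IsSharp, ∀ t : 𝕜,
          ∃ Φ' : TridiagonalPerturbation.ParallelSystem 𝕜 V d,
            TridiagonalPerturbation.IsLinearPerturbation Φ K t Φ' ∧
            ∃ hΦ' : Φ'.IsSharp,
              Φ'.parameterArray hΦ' =
                (Φ.eigenvalue, Φ.dualEigenvalue,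
                  fun i : Fin (d + 1) => t ^ (i : ℕ) * Φ.splitSequence hΦ i) := by
  have hinj := Φ.ordering_star_spec.injective
  refine ⟨⟨Φ.splitSpace, Φ.isSplitDecomposition_splitSpace, fun U hU => hU.eq_splitSpace⟩,
    fun U hU => ⟨?_, fun K hK => ⟨TridiagonalPerturbation.TridiagonalSystem.isSharp hq0 hq hθ,
      fun t => hU.exists_perturbation (fun i u hu => ?_) _ t⟩⟩⟩
  · have := TridiagonalPerturbation.existsUnique_eigenspace_eq hinj hU.isInternal
    simpa only [hθstar, TridiagonalPerturbation.IsWeightMap] using this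
  · rw [hθstar]
    exact Module.End.mem_eigenspace_iff.mp ((hK i).symm ▸ hu)
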